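/- A base game consists of a finite set $I$ of players, a finite set $\Theta$ of payoff states with a full-support prior $\pi\in\Delta(\Theta)$, and for each player $i$ a finite action set $A_i$ and a utility function $u_i:A\times\Theta\to\mathbb{R}$, where $A=\prod_{i}A_i$. An outcome is an element of $\Delta_\pi(A\times\Theta)$, the set of probability measures on $A\times\Theta$ whose marginal on $\Theta$ is $\pi$. An information technology consists of a finite set $Z$, a Markov kernel $\zeta:\Theta\to\Delta(Z)$ and, for each player $i$, a finite signal space $X_i$ with more elements than $A_i$ and than $Z\times\Theta$, a set $\mathcal{E}_i\subseteq\Delta(X_i)^{Z\times\Theta}$ of feasible experiments, and a cost function $C_i:\mathcal{E}_i\to\mathbb{R}_+$ with $C_i(\xi_i)=0$ for some $\xi_i\in\mathcal{E}_i$. In the information acquisition game each player $i$ chooses an experiment $\xi_i\in\mathcal{E}_i$ and an action plan $\sigma_i:X_i\to\Delta(A_i)$; a profile $(\xi^*,\sigma^*)$ is an equilibrium if for every $i$ the pair $(\xi_i^*,\sigma_i^*)$ maximizes \[ \sum_{a,x,z,\theta}u_i(a,\theta)\,\sigma_i(a_i|x_i)\,\xi_i(x_i|z,\theta)\prod_{j\ne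 i}\sigma_j^*(a_j|x_j)\,\xi_j^*(x_j|z,\theta)\,\zeta(z|\theta)\,\pi(\theta)-C_i(\xi_i) \] over all $\xi_i\in\mathcal{E}_i$ and $\sigma_i:X_i\to\Delta(A_i)$. Its outcome is the induced joint distribution $q(a,\theta)=\sum_{x,z}\prod_{j}\sigma_j^*(a_j|x_j)\,\xi_j^*(x_j|z,\theta)\,\zeta(z|\theta)\,\pi(\theta)$. Write $\xi_i\succsim\xi_i'$ if there is a Markov kernel $g:X_i\to\Delta(X_i)$ with $\xi_i'(x_i|z,\theta)=\sum_{x_i'}g(x_i|x_i')\,\xi_i(x_i'|z,\theta)$ for all $x_i\in X_i$ and all $(z,\theta)$ with $\zeta(z|\theta)>0$, and $\xi_i\succ\xi_i'$ if $\xi_i\succsim\xi_i'$ but not $\xi_i'\succsim\xi_i$. The cost $C_i$ is monotone if $\xi_i\succsim\xi_i'$ implies $C_i(\xi_i)\ge C_i(\xi_i')$ and $\xi_i\succ\xi_i'$ implies $C_i(\xi_i)>C_i(\xi_i')$, for all $\xi_i,\xi_i'\in\mathcal{E}_i$. The technology represents unconstrained rational inattention if, for every $i$, $\mathcal{E}_i=\Delta(X_i)^{Z\times\Theta}$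 and $C_i$ is monotone. An outcome $p$ is a vanishing-cost equilibrium if for every $\varepsilon>0$ there are a technology representing unconstrained rational inattention and an equilibrium of the corresponding information acquisition game, with outcome $q$, such that $\max C_i(\mathcal{E}_i)\le\varepsilon$ and $|p(a,\theta)-q(a,\theta)|\le\varepsilon$ for all $i\in I$, $a\in A$ and $\theta\in\Theta$. An outcome $p$ is a complete-information Nash equilibrium if for every $\theta\in\Theta$ there are $\alpha_{\theta,i}\in\Delta(A_i)$, $i\in I$, such that $p(a,\theta)/\pi(\theta)=\prod_i\alpha_{\theta,i}(a_i)$ for all $a\in A$ and, for every $i$, $\alpha_{\theta,i}$ maximizes $\sum_a u_i(a,\theta)\,\beta_i(a_i)\prod_{j\neq i}\alpha_{\theta,j}(a_j)$ over $\beta_i\in\Delta(A_i)$. For an outcome $p$, let $p(a_i)$ be the probability of $a_i\in A_i$ and, if $p(a_i)>0$, let $p_{a_i}$ be the conditional distribution of $(a_{-i},\theta)$ given $a_i$ and $BR(p_{a_i})$ the set of $b_i\in A_i$ maximizing $\sum_{a_{-i},\theta}u_i(b_i,a_{-i},\theta)\,p_{a_i}(a_{-i},\theta)$. A separated Bayes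 correlated equilibrium (sBCE) is an outcome $p$ such that, for all $i\in I$: \begin{itemize} \item $\sum_{a_{-i},\theta}\bigl(u_i(a_i,a_{-i},\theta)-u_i(b_i,a_{-i},\theta)\bigr)\,p(a_i,a_{-i},\theta)\ge 0$ for all $a_i,b_i\in A_i$; and \item for all $a_i,b_i\in A_i$ with $p(a_i)>0$ and $p(b_i)>0$, if $p_{a_i}\neq p_{b_i}$ then $BR(p_{a_i})\cap BR(p_{b_i})=\varnothing$. \end{itemize} \textbf{Theorem.} Fix a base game. A complete-information Nash equilibrium $p$ is a vanishing-cost equilibrium if and only if it belongs to the closure of the set of separated Bayes correlated equilibria. -/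

import Mathlib

open scoped NNReal

namespace RationalInattention

/-- A base game `(I, Θ, π, (A i, u i))`, with the finite sets of players, payoff states and actions
as parameters: a full-support prior and the players' utility functions. -/
structure BaseGame (I Θ : Type*) (A : I → Type*) [Fintype Θ] where
  /-- the prior `π ∈ Δ(Θ)` -/
  prior : stdSimplex ℝ Θ
  prior_pos : ∀ θ, 0 < prior.1 θ
  /-- the utility functions `u i : A × Θ → ℝ` -/
  u : (i : I) → (∀ j, A j) → Θ → ℝ

/-- An experiment, i.e. a Markov kernel `Z × Θ → Δ(X)`; `ξ z θ` is the law of the signal. -/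
abbrev Experiment (Z Θ X : Type*) [Fintype X] := Z → Θ → stdSimplex ℝ X

/-- An action plan, i.e. a Markov kernel `X → Δ(B)`. -/
abbrev ActionPlan (X B : Type*) [Fintype B] := X → stdSimplex ℝ B

/-- An information technology `(Z, ζ, (X i, 𝓔 i, C i))`. -/
structure Technology (I Θ : Type*) (A : I → Type*) [Fintype Θ] [∀ i, Fintype (A i)] where
  /-- the finite set of values of the correlation state -/
  Z : Type
  [fintypeZ : Fintype Z]
  /-- the conditional law of `z` given `θ` -/
  ζ : Θ → stdSimplex ℝ Z
  /-- the finite signal spaces -/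
  X : I → Type
  [fintypeX : ∀ i, Fintype (X i)]
  /-- signal spaces are rich -/
  card_action_lt : ∀ i, Fintype.card (A i) < Fintype.card (X i)
  card_state_lt : ∀ i, Fintype.card (Z × Θ) < Fintype.card (X i)
  /-- the feasible experiments -/
  feasible : (i : I) → Set (Experiment Z Θ (X i))
  /-- the costs of the feasible experiments -/
  cost : (i : I) → feasible i → ℝ≥0
  /-- normalization: some feasible experiment is free -/
  exists_cost_eq_zero : ∀ i, ∃ e : feasible i, cost i e = 0

attribute [instance] Technology.fintypeZ Technology.fintypeX

section Technology

variable {I Θ : Type*} {A : I → Type*} [Fintype Θ] [∀ i, Fintype (A i)]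

/-- `e` Blackwell dominates `e'`: the law of `e'` is a garbling of the law of `e`, at every state
`(z, θ)` with `ζ(z | θ) > 0`. -/
def Technology.BlackwellDominates (T : Technology I Θ A) {i : I}
    (e e' : Experiment T.Z Θ (T.X i)) : Prop :=
  ∃ g : T.X i → stdSimplex ℝ (T.X i), ∀ (x : T.X i) (θ : Θ) (z : T.Z), 0 < (T.ζ θ).1 z →
    (e' z θ).1 x = ∑ y : T.X i, (g y).1 x * (e z θ).1 y

/-- The cost function of player `i` is monotone in the Blackwell order (strictly so along strict
domination). -/
def Technology.IsMonotoneCost (T : Technology I Θ A) (i : I) : Prop :=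
  ∀ e e' : T.feasible i, T.BlackwellDominates e.1 e'.1 →
    T.cost i e' ≤ T.cost i e ∧
      (¬ T.BlackwellDominates e'.1 e.1 → T.cost i e' < T.cost i e)

/-- Unconstrained rational inattention: all experiments are feasible, costs are monotone. -/
def Technology.IsUnconstrainedRI (T : Technology I Θ A) : Prop :=
  ∀ i, T.feasible i = Set.univ ∧ T.IsMonotoneCost i

end Technology

section Games

variable {I Θ : Type*} {A : I → Type*} [Fintype I] [DecidableEq I] [Fintype Θ]
  [∀ i, Fintype (A i)]

/-- Gross expected payoff of player `i` from the strategy `(e, s)` when the others play according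
to `(ξ, σ)`. -/
noncomputable def BaseGame.grossPayoff (G : BaseGame I Θ A) (T : Technology I Θ A) (i : I)
    (e : Experiment T.Z Θ (T.X i)) (s : ActionPlan (T.X i) (A i))
    (ξ : ∀ j, Experiment T.Z Θ (T.X j)) (σ : ∀ j, ActionPlan (T.X j) (A j)) : ℝ :=
  ∑ a : (∀ j, A j), ∑ x : (∀ j, T.X j), ∑ z : T.Z, ∑ θ : Θ,
    G.u i a θ * (s (x i)).1 (a i) * (e z θ).1 (x i) *
      (∏ j ∈ Finset.univ.erase i, (σ j (x j)).1 (a j) * (ξ j z θ).1 (x j)) *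
      (T.ζ θ).1 z * G.prior.1 θ

/-- `(ξ, σ)` is a Nash equilibrium of the information acquisition game `(G, T)`. -/
def BaseGame.IsEquilibrium (G : BaseGame I Θ A) (T : Technology I Θ A)
    (ξ : ∀ i, T.feasible i) (σ : ∀ i, ActionPlan (T.X i) (A i)) : Prop :=
  ∀ (i : I) (e : T.feasible i) (s : ActionPlan (T.X i) (A i)),
    G.grossPayoff T i e.1 s (fun j => (ξ j).1) σ - T.cost i e ≤
      G.grossPayoff T i (ξ i).1 (σ i) (fun j => (ξ j).1) σ - T.cost i (ξ i)

/-- The outcome of a strategy profile: the joint law of actions and payoff state. -/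
noncomputable def BaseGame.outcomeOf (G : BaseGame I Θ A) (T : Technology I Θ A)
    (ξ : ∀ i, T.feasible i) (σ : ∀ i, ActionPlan (T.X i) (A i)) : (∀ i, A i) × Θ → ℝ :=
  fun aθ => ∑ x : (∀ j, T.X j), ∑ z : T.Z,
    (∏ j, (σ j (x j)).1 (aθ.1 j) * ((ξ j).1 z aθ.2).1 (x j)) *
      (T.ζ aθ.2).1 z * G.prior.1 aθ.2

/-- `Δ_π(A × Θ)`: the probability measures on `A × Θ` with marginal `π` on `Θ`. -/
def BaseGame.outcomes (G : BaseGame I Θ A) : Set ((∀ i, A i) × Θ → ℝ) :=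
  {p | p ∈ stdSimplex ℝ ((∀ i, A i) × Θ) ∧ ∀ θ, ∑ a, p (a, θ) = G.prior.1 θ}

/-- `p` is a vanishing cost equilibrium. -/
def BaseGame.IsVanishingCostEquilibrium (G : BaseGame I Θ A) (p : (∀ i, A i) × Θ → ℝ) : Prop :=
  p ∈ G.outcomes ∧ ∀ ε : ℝ, 0 < ε →
    ∃ T : Technology I Θ A, T.IsUnconstrainedRI ∧
      ∃ (ξ : ∀ i, T.feasible i) (σ : ∀ i, ActionPlan (T.X i) (A i)),
        G.IsEquilibrium T ξ σ ∧
        (∀ (i : I) (e : T.feasible i), (T.cost i e : ℝ) ≤ ε) ∧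
        ∀ (a : ∀ i, A i) (θ : Θ), |p (a, θ) - G.outcomeOf T ξ σ (a, θ)| ≤ ε

/-- `p` is a complete-information Nash equilibrium. -/
def BaseGame.IsCompleteInfoNash (G : BaseGame I Θ A) (p : (∀ i, A i) × Θ → ℝ) : Prop :=
  p ∈ G.outcomes ∧ ∀ θ : Θ, ∃ α : ∀ i, stdSimplex ℝ (A i),
    (∀ a : (∀ i, A i), p (a, θ) / G.prior.1 θ = ∏ i, (α i).1 (a i)) ∧
    ∀ (i : I) (β : stdSimplex ℝ (A i)),
      ∑ a : (∀ j, A j), G.u i a θ * β.1 (a i) * ∏ j ∈ Finset.univ.erase i, (α j).1 (a j) ≤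
        ∑ a : (∀ j, A j), G.u i a θ * (α i).1 (a i) *
          ∏ j ∈ Finset.univ.erase i, (α j).1 (a j)

/-- Action profiles `A_{-i}` of the players other than `i`. -/
abbrev Others (A : I → Type*) (i : I) := ∀ j : {j : I // j ≠ i}, A j

/-- The action profile `(aᵢ, a₋ᵢ)`. -/
def profile (i : I) (ai : A i) (am : Others A i) : ∀ j, A j :=
  (Equiv.piSplitAt i A).symm (ai, am)

/-- The expectation of `u i (bᵢ, ·)` under a (not necessarily normalized) distribution `m` of the
others' actions and the payoff state. -/
noncomputable def BaseGame.expectedUtility (G : BaseGame I Θ A) (i : I) (bi : A i)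
    (m : Others A i × Θ → ℝ) : ℝ :=
  ∑ am : Others A i, ∑ θ : Θ, G.u i (profile i bi am) θ * m (am, θ)

/-- The set of best responses of player `i` to the belief `m`. -/
def BaseGame.bestResponses (G : BaseGame I Θ A) (i : I) (m : Others A i × Θ → ℝ) : Set (A i) :=
  {bi | ∀ ci : A i, G.expectedUtility i ci m ≤ G.expectedUtility i bi m}

/-- `p(aᵢ)`, the probability that player `i` takes action `aᵢ`. -/
noncomputable def actionProb (p : (∀ i, A i) × Θ → ℝ) (i : I) (ai : A i) : ℝ :=
  ∑ am : Others A i, ∑ θ : Θ, p (profile i ai am, θ)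

/-- `p_{aᵢ}`, the conditional law of the others' actions and the payoff state given `aᵢ`
(only meaningful if `p(aᵢ) > 0`). -/
noncomputable def condBelief (p : (∀ i, A i) × Θ → ℝ) (i : I) (ai : A i) :
    Others A i × Θ → ℝ :=
  fun y => p (profile i ai y.1, y.2) / actionProb p i ai

/-- `p` is a Bayes correlated equilibrium: an outcome satisfying the obedience constraint. -/
def BaseGame.IsBCE (G : BaseGame I Θ A) (p : (∀ i, A i) × Θ → ℝ) : Prop :=
  p ∈ G.outcomes ∧ ∀ (i : I) (ai bi : A i),
    0 ≤ ∑ am : Others A i, ∑ θ : Θ,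
      (G.u i (profile i ai am) θ - G.u i (profile i bi am) θ) * p (profile i ai am, θ)

/-- The separation constraint: distinct beliefs have separate best responses. -/
def BaseGame.SatisfiesSeparation (G : BaseGame I Θ A) (p : (∀ i, A i) × Θ → ℝ) : Prop :=
  ∀ (i : I) (ai bi : A i), 0 < actionProb p i ai → 0 < actionProb p i bi →
    condBelief p i ai ≠ condBelief p i bi →
      G.bestResponses i (condBelief p i ai) ∩ G.bestResponses i (condBelief p i bi) = ∅

/-- The set of separated Bayes correlated equilibria. -/
def BaseGame.sBCE (G : BaseGame I Θ A) : Set ((∀ i, A i) × Θ → ℝ) :=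
  {p | G.IsBCE p ∧ G.SatisfiesSeparation p}

end Games

end RationalInattention

/-! Necessity. Every equilibrium outcome under unconstrained rational inattention is an sBCE
(`outcomeOf_mem_sBCE`), so a limit of such outcomes lies in the closure. A player may replace the
experiment by one that reports only the action it would have led to. This is a garbling, hence no
more costly, and obedience follows. If two actions with different beliefs shared a best response,
merging their recommendations and playing that response would lose no payoff and would strictly
lower the cost, because merging destroys information (`not_blackwellDominates_relabel`).

Sufficiency. Take an sBCE `q` close to the Nash outcome `p`, with `q ≥ (1 - δ) p`. Let the
correlation state be `none` with probability `1 - δ`, where the Nash strategies are played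
independently, and otherwise be an action profile drawn from the normalized remainder of `q`. Each
player's signal is a label of the belief induced by the drawn action, and the action is then redrawn
from its conditional law given that belief. Redrawing leaves `q` unchanged (`mixture_redrawnLaw`),
and separation now says that distinct signals of positive probability have disjoint sets of best
responses. Even full knowledge of `(z, θ)` is worth little: in state `none` play is nearly Nash, and
the other states have total probability `δ`.

It remains to find, for each player separately, a small monotone cost under which the prescribed
experiment is optimal (`exists_small_monotone_cost`). The cost is built from a sum over signals of a
sublinear function of the unnormalized posterior, which dominates the indirect utility and touches
it at the prescribed posteriors. Separation leaves room to add a small multiple of the norm, which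
makes the sum strictly monotone in the Blackwell order (`exists_reverse_garbling`). -/

namespace RationalInattention

/-! ### Blackwell order and sublinear functions of unnormalized posteriors. -/

section Garbling

/-- A kernel-weighted recombination `v'` of a vector family `v` does not increase the sum of a
sublinear functional. -/
theorem sum_sublinear_garbling_le {E X Y : Type*} [AddCommGroup E] [Module ℝ E] [Fintype X]
    [Fintype Y] {φ : E → ℝ} (h0 : φ 0 = 0) (hadd : ∀ u v, φ (u + v) ≤ φ u + φ v)
    (hsmul : ∀ (c : ℝ) (v : E), 0 ≤ c → φ (c • v) = c * φ v)
    (g : Y → stdSimplex ℝ X) (v : Y → E) :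
    ∑ x, φ (∑ y, (g y).1 x • v y) ≤ ∑ y, φ (v y) := by
  have hsum : ∀ x, φ (∑ y, (g y).1 x • v y) ≤ ∑ y, (g y).1 x * φ (v y) := by
    intro x
    refine (Finset.le_sum_of_subadditive φ h0.le hadd Finset.univ _).trans (le_of_eq ?_)
    exact Finset.sum_congr rfl fun y _ => hsmul _ _ ((g y).2.1 x)
  refine (Finset.sum_le_sum fun x _ => hsum x).trans (le_of_eq ?_)
  rw [Finset.sum_comm]
  refine Finset.sum_congr rfl fun y _ => ?_
  rw [← Finset.sum_mul, (g y).2.2, one_mul]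

/-- If a garbling preserves the sum of the norms, then it can be reversed. -/
theorem exists_reverse_garbling {E X : Type*} [NormedAddCommGroup E] [InnerProductSpace ℝ E]
    [Fintype X] (g : X → stdSimplex ℝ X) (v : X → E)
    (h : ∑ y, ‖v y‖ ≤ ∑ x, ‖∑ y, (g y).1 x • v y‖) :
    ∃ k : X → stdSimplex ℝ X, ∀ y, v y = ∑ x, (k x).1 y • ∑ y', (g y').1 x • v y' := by
  classical
  set v' : X → E := fun x => ∑ y, (g y).1 x • v y with hv'
  have hn : ∀ x y, ‖(g y).1 x • v y‖ = (g y).1 x * ‖v y‖ := fun x y => by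
    rw [norm_smul, Real.norm_of_nonneg ((g y).2.1 x)]
  have hle : ∀ x, ‖v' x‖ ≤ ∑ y, (g y).1 x * ‖v y‖ := fun x => by
    refine (norm_sum_le _ _).trans (le_of_eq (Finset.sum_congr rfl fun y _ => hn x y))
  have htot : ∑ x, ∑ y, (g y).1 x * ‖v y‖ = ∑ y, ‖v y‖ := by
    rw [Finset.sum_comm]
    refine Finset.sum_congr rfl fun y _ => ?_
    rw [← Finset.sum_mul, (g y).2.2, one_mul]
  -- The totals agree, so the triangle inequality is an equality at each `x` separately.
  have heq : ∀ x, ‖v' x‖ = ∑ y, (g y).1 x * ‖v y‖ := by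
    have := (Finset.sum_eq_sum_iff_of_le fun x (_ : x ∈ Finset.univ) => hle x).1
      (le_antisymm (Finset.sum_le_sum fun x _ => hle x) (by rw [htot]; exact h))
    exact fun x => this x (Finset.mem_univ x)
  -- Equality in the triangle inequality forces equality in Cauchy–Schwarz for each summand against
  -- `v' x`, so every summand is a nonnegative multiple of `v' x` when `v' x` is nonzero.
  have hprop : ∀ x y, ‖v' x‖ • ((g y).1 x • v y) = ((g y).1 x * ‖v y‖) • v' x := by
    intro x
    have hin : ∀ y ∈ Finset.univ, inner ℝ ((g y).1 x • v y) (v' x) ≤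
        ((g y).1 x * ‖v y‖) * ‖v' x‖ := fun y _ => by
      rw [← hn]; exact real_inner_le_norm _ _
    have hs : ∑ y, inner ℝ ((g y).1 x • v y) (v' x) = ∑ y, ((g y).1 x * ‖v y‖) * ‖v' x‖ := by
      rw [← sum_inner, ← Finset.sum_mul, ← heq x]
      exact real_inner_self_eq_norm_mul_norm (v' x)
    intro y
    have hy := (Finset.sum_eq_sum_iff_of_le hin).1 hs y (Finset.mem_univ y)
    rw [← hn] at hy ⊢
    exact inner_eq_norm_mul_iff_real.1 hy
  -- The reverse kernel splits `v' x` in proportion to the norms of its summands. If `v' x = 0`, all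
  -- summands vanish and any law serves.
  have hk : ∀ x, ∃ k : stdSimplex ℝ X, ∀ y, (g y).1 x • v y = k.1 y • v' x := by
    intro x
    by_cases hx : v' x = 0
    · refine ⟨stdSimplex.vertex x, fun y => ?_⟩
      have h1 : ∑ y, (g y).1 x * ‖v y‖ = 0 := by rw [← heq x, hx, norm_zero]
      have h2 := (Finset.sum_eq_zero_iff_of_nonneg fun y _ =>
        mul_nonneg ((g y).2.1 x) (norm_nonneg (v y))).1 h1 y (Finset.mem_univ y)
      rw [hx, smul_zero, ← norm_eq_zero, hn, h2]
    · have hpos : ‖v' x‖ ≠ 0 := norm_ne_zero_iff.2 hx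
      refine ⟨⟨fun y => (g y).1 x * ‖v y‖ / ‖v' x‖, fun y => div_nonneg
        (mul_nonneg ((g y).2.1 x) (norm_nonneg _)) (norm_nonneg _), ?_⟩, fun y => ?_⟩
      · rw [← Finset.sum_div, ← heq x, div_self hpos]
      · change _ = ((g y).1 x * ‖v y‖ / ‖v' x‖) • v' x
        rw [div_eq_inv_mul, mul_smul, ← hprop, smul_smul, inv_mul_cancel₀ hpos, one_smul]
  choose k hk using hk
  refine ⟨k, fun y => ?_⟩
  calc v y = ∑ x, (g y).1 x • v y := by rw [← Finset.sum_smul, (g y).2.2, one_smul]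
    _ = _ := Finset.sum_congr rfl fun x _ => hk x y

variable {S X B : Type*} [Fintype X]

/-- `e'` is a garbling of `e` on the support of `w`. -/
def IsGarbling (w : S → ℝ) (e e' : S → stdSimplex ℝ X) : Prop :=
  ∃ g : X → stdSimplex ℝ X, ∀ x s, 0 < w s → (e' s).1 x = ∑ y, (g y).1 x * (e s).1 y

/-- The unnormalized posterior after the signal `x`. -/
noncomputable def posterior (w : S → ℝ) (e : S → stdSimplex ℝ X) (x : X) : EuclideanSpace ℝ S :=
  WithLp.toLp 2 fun s => w s * (e s).1 x

/-- The payoff of the action plan `r` after the experiment `e`. -/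
noncomputable def planPayoff [Fintype S] [Fintype B] (w : S → ℝ) (U : B → S → ℝ)
    (e : S → stdSimplex ℝ X) (r : X → stdSimplex ℝ B) : ℝ :=
  ∑ x, ∑ b, (r x).1 b * ∑ s, U b s * (w s * (e s).1 x)

/-- Weighting by `w` erases the states outside its support, so garbling becomes a linear
recombination of vectors, to which norms and inner products apply. -/
theorem posterior_garbling [Fintype S] {w : S → ℝ} (hw : ∀ s, 0 ≤ w s)
    {e e' : S → stdSimplex ℝ X} (g : X → stdSimplex ℝ X) :
    (∀ x s, 0 < w s → (e' s).1 x = ∑ y, (g y).1 x * (e s).1 y) ↔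
      ∀ x, posterior w e' x = ∑ y, (g y).1 x • posterior w e y := by
  constructor
  · intro h x
    ext s
    simp only [posterior, WithLp.ofLp_sum, WithLp.ofLp_smul, Finset.sum_apply, Pi.smul_apply,
      smul_eq_mul]
    rcases (hw s).eq_or_lt with h0 | h0
    · simp [← h0]
    · rw [h x s h0, Finset.mul_sum]
      exact Finset.sum_congr rfl fun y _ => by ring
  · intro h x s hs
    have h1 := congrArg (fun v : EuclideanSpace ℝ S => v s) (h x)
    simp only [posterior, WithLp.ofLp_sum, WithLp.ofLp_smul, Finset.sum_apply, Pi.smul_apply,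
      smul_eq_mul] at h1
    apply mul_left_cancel₀ hs.ne'
    rw [h1, Finset.mul_sum]
    exact Finset.sum_congr rfl fun y _ => by ring

theorem inner_posterior [Fintype S] (w : S → ℝ) (e : S → stdSimplex ℝ X) (U : S → ℝ) (x : X) :
    inner ℝ (WithLp.toLp 2 U : EuclideanSpace ℝ S) (posterior w e x) =
      ∑ s, U s * (w s * (e s).1 x) := by
  simp [posterior, PiLp.inner_apply, mul_comm]

/-- The norm is bounded by the unnormalized probability of the signal. This controls the total of
the norm terms by the mass of `w`, and shows that a nonzero posterior has positive probability. -/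
theorem norm_posterior_le [Fintype S] {w : S → ℝ} (hw : ∀ s, 0 ≤ w s)
    (e : S → stdSimplex ℝ X) (x : X) : ‖posterior w e x‖ ≤ ∑ s, w s * (e s).1 x := by
  classical
  have h : posterior w e x = ∑ s, EuclideanSpace.single s (w s * (e s).1 x) := by
    ext t
    simp [posterior, WithLp.ofLp_sum, Finset.sum_apply]
  rw [h]
  refine (norm_sum_le _ _).trans (le_of_eq (Finset.sum_congr rfl fun s _ => ?_))
  rw [PiLp.norm_single, Real.norm_of_nonneg (mul_nonneg (hw s) ((e s).2.1 x))]

/-- The support function of a finite family of vectors plus a multiple of the norm. -/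
noncomputable def normSup {E : Type*} [NormedAddCommGroup E] [InnerProductSpace ℝ E]
    [Fintype B] [Nonempty B] (η : ℝ) (L : B → E) (m : E) : ℝ :=
  η * ‖m‖ + Finset.univ.sup' Finset.univ_nonempty fun b => inner ℝ (L b) m

section NormSup

variable {E : Type*} [NormedAddCommGroup E] [InnerProductSpace ℝ E] [Fintype B] [Nonempty B]

theorem normSup_eq (η : ℝ) (L : B → E) (m : E) :
    normSup η L m = η * ‖m‖ + normSup 0 L m := by simp [normSup]

theorem le_normSup (η : ℝ) (L : B → E) (m : E) (b : B) :
    η * ‖m‖ + inner ℝ (L b) m ≤ normSup η L m :=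
  add_le_add_right (Finset.le_sup' (fun b => inner ℝ (L b) m) (Finset.mem_univ b)) _

theorem normSup_le {η : ℝ} {L : B → E} {m : E} {c : ℝ}
    (h : ∀ b, η * ‖m‖ + inner ℝ (L b) m ≤ c) : normSup η L m ≤ c := by
  have : (Finset.univ.sup' Finset.univ_nonempty fun b => inner ℝ (L b) m) ≤ c - η * ‖m‖ :=
    Finset.sup'_le _ _ fun b _ => by linarith [h b]
  unfold normSup
  linarith

theorem normSup_zero_right (η : ℝ) (L : B → E) : normSup η L 0 = 0 := by simp [normSup]

theorem normSup_add_le {η : ℝ} (hη : 0 ≤ η) (L : B → E) (u v : E) :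
    normSup η L (u + v) ≤ normSup η L u + normSup η L v :=
  normSup_le fun b => by
    have h1 := le_normSup η L u b
    have h2 := le_normSup η L v b
    have h3 := mul_le_mul_of_nonneg_left (norm_add_le u v) hη
    rw [inner_add_right]
    linarith

theorem normSup_smul (η : ℝ) (L : B → E) (c : ℝ) (v : E) (hc : 0 ≤ c) :
    normSup η L (c • v) = c * normSup η L v := by
  rcases hc.eq_or_lt with rfl | hc'
  · simp [normSup_zero_right]
  have key : ∀ (c : ℝ) (v : E), 0 < c → normSup η L (c • v) ≤ c * normSup η L v :=
    fun c v hc => normSup_le fun b => by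
      have h1 := mul_le_mul_of_nonneg_left (le_normSup η L v b) hc.le
      rw [norm_smul, Real.norm_of_nonneg hc.le, inner_smul_right]
      linarith
  refine le_antisymm (key c v hc') ?_
  have h2 := mul_le_mul_of_nonneg_left (key c⁻¹ (c • v) (inv_pos.2 hc')) hc
  rwa [smul_smul, inv_mul_cancel₀ hc'.ne', one_smul, ← mul_assoc, mul_inv_cancel₀ hc'.ne',
    one_mul] at h2

/-- A total of `normSup` over posteriors is monotone in the Blackwell order, strictly so along
strict domination. -/
theorem sum_normSup_posterior_mono [Fintype S] {w : S → ℝ} (hw : ∀ s, 0 ≤ w s) {η : ℝ}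
    (hη : 0 < η) (L : B → EuclideanSpace ℝ S) {e e' : S → stdSimplex ℝ X}
    (h : IsGarbling w e e') :
    ∑ x, normSup η L (posterior w e' x) ≤ ∑ x, normSup η L (posterior w e x) ∧
      (¬ IsGarbling w e' e →
        ∑ x, normSup η L (posterior w e' x) < ∑ x, normSup η L (posterior w e x)) := by
  obtain ⟨g, hg⟩ := h
  rw [posterior_garbling hw] at hg
  have hmono : ∀ η : ℝ, 0 ≤ η →
      ∑ x, normSup η L (posterior w e' x) ≤ ∑ x, normSup η L (posterior w e x) := by
    intro η hη
    simp only [hg]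
    exact sum_sublinear_garbling_le (normSup_zero_right η L) (normSup_add_le hη L)
      (normSup_smul η L) g _
  refine ⟨hmono η hη.le, fun hn => ?_⟩
  by_contra! hcon
  apply hn
  -- The part without the norm is already weakly monotone. If the total does not drop, neither does
  -- the sum of norms, and the garbling can be reversed.
  have h0 := hmono 0 le_rfl
  simp only [normSup_eq η, Finset.sum_add_distrib, ← Finset.mul_sum] at hcon
  have hnorm : ∑ x, ‖posterior w e x‖ ≤ ∑ x, ‖posterior w e' x‖ :=
    le_of_mul_le_mul_left (by linarith) hη
  simp only [hg] at hnorm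
  obtain ⟨k, hk⟩ := exists_reverse_garbling g _ hnorm
  refine ⟨k, (posterior_garbling hw k).2 fun x => ?_⟩
  simp only [hg]
  exact hk x

end NormSup

end Garbling

/-! ### A small monotone cost that supports a given experiment. -/

section CostConstruction

variable {S X B : Type*} [Fintype S] [Fintype X] [Fintype B]

/-- The payoff of the action `b` on the event that the signal is `x`. -/
noncomputable def signalPayoff (w : S → ℝ) (U : B → S → ℝ) (e : S → stdSimplex ℝ X) (x : X)
    (b : B) : ℝ :=
  ∑ s, U b s * (w s * (e s).1 x)

theorem planPayoff_eq (w : S → ℝ) (U : B → S → ℝ) (e : S → stdSimplex ℝ X)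
    (r : X → stdSimplex ℝ B) :
    planPayoff w U e r = ∑ x, ∑ b, (r x).1 b * signalPayoff w U e x b := rfl

/-- The vectors whose support function, plus `η` times the norm, dominates the indirect utility
and touches it at the posteriors of `e₀`. -/
theorem exists_support_vectors [Nonempty B] {w : S → ℝ} (hw : ∀ s, 0 ≤ w s) {U : B → S → ℝ}
    {e₀ : S → stdSimplex ℝ X}
    (hsep : ∀ x x' b, posterior w e₀ x ≠ 0 → posterior w e₀ x' ≠ 0 →
      (∀ c, signalPayoff w U e₀ x c ≤ signalPayoff w U e₀ x b) →
      (∀ c, signalPayoff w U e₀ x' c ≤ signalPayoff w U e₀ x' b) → x = x')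
    {κ : ℝ} (hκ : 0 < κ) :
    ∃ η : ℝ, 0 < η ∧ η ≤ κ ∧ ∃ L : B → EuclideanSpace ℝ S,
      (∀ (e : S → stdSimplex ℝ X) x b,
        signalPayoff w U e x b ≤ normSup η L (posterior w e x)) ∧
      (∀ x b, (∀ c, signalPayoff w U e₀ x c ≤ signalPayoff w U e₀ x b) →
        normSup η L (posterior w e₀ x) ≤ signalPayoff w U e₀ x b) ∧
      ∀ (e : S → stdSimplex ℝ X) x, ∃ r : B,
        normSup η L (posterior w e x) ≤
          signalPayoff w U e x r + 2 * η * ∑ s, w s * (e s).1 x := by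
  classical
  -- Finitely many strict inequalities survive a small perturbation. The factor 2 pays for the norm
  -- term and for the perturbation by `μ` below.
  have hη : ∃ η : ℝ, 0 < η ∧ η ≤ κ ∧ ∀ x b c,
      signalPayoff w U e₀ x c < signalPayoff w U e₀ x b →
        signalPayoff w U e₀ x c + 2 * η * ‖posterior w e₀ x‖ ≤ signalPayoff w U e₀ x b := by
    have h : ∀ᶠ η : ℝ in nhdsWithin 0 (Set.Ioi 0), 0 < η ∧ η ≤ κ ∧ ∀ x b c,
      signalPayoff w U e₀ x c < signalPayoff w U e₀ x b →
        signalPayoff w U e₀ x c + 2 * η * ‖posterior w e₀ x‖ ≤ signalPayoff w U e₀ x b := by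
      simp only [Filter.eventually_and, Filter.eventually_all]
      refine ⟨self_mem_nhdsWithin, nhdsWithin_le_nhds (eventually_le_nhds hκ), fun x b c h => ?_⟩
      have hc : Continuous fun η : ℝ =>
        signalPayoff w U e₀ x c + 2 * η * ‖posterior w e₀ x‖ := by fun_prop
      have := hc.tendsto 0
      simp only [mul_zero, zero_mul, add_zero] at this
      exact nhdsWithin_le_nhds ((this.eventually_lt_const h).mono fun _ h => h.le)
    exact h.exists
  obtain ⟨η, hη0, hηκ, hgap⟩ := hη
  -- By separation at most one signal has a nonzero posterior at which `b` is optimal; `μ b` is the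
  -- unit vector along that posterior, or zero if there is none.
  have hμ : ∀ b, ∃ μ : EuclideanSpace ℝ S, ‖μ‖ ≤ 1 ∧ ∀ x,
      (∀ c, signalPayoff w U e₀ x c ≤ signalPayoff w U e₀ x b) →
        inner ℝ μ (posterior w e₀ x) = ‖posterior w e₀ x‖ := by
    intro b
    by_cases h : ∃ x, posterior w e₀ x ≠ 0 ∧
      ∀ c, signalPayoff w U e₀ x c ≤ signalPayoff w U e₀ x b
    · obtain ⟨x, hx, hb⟩ := h
      have hx' := norm_ne_zero_iff.2 hx
      refine ⟨‖posterior w e₀ x‖⁻¹ • posterior w e₀ x, ?_, fun x' hb' => ?_⟩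
      · rw [norm_smul, norm_inv, norm_norm, inv_mul_cancel₀ hx']
      · by_cases h0 : posterior w e₀ x' = 0
        · simp [h0]
        · obtain rfl := hsep x x' b hx h0 hb hb'
          rw [real_inner_smul_left, real_inner_self_eq_norm_mul_norm, inv_mul_cancel_left₀ hx']
    · refine ⟨0, by simp, fun x hb => ?_⟩
      have : posterior w e₀ x = 0 := by
        by_contra h0
        exact h ⟨x, h0, hb⟩
      simp [this]
  choose μ hμ1 hμ using hμ
  have hinner : ∀ b (e : S → stdSimplex ℝ X) x,
      inner ℝ ((WithLp.toLp 2 (U b) : EuclideanSpace ℝ S) - η • μ b) (posterior w e x) =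
        signalPayoff w U e x b - η * inner ℝ (μ b) (posterior w e x) := by
    intro b e x
    rw [inner_sub_left, inner_posterior, real_inner_smul_left]
    rfl
  have hbound : ∀ b (m : EuclideanSpace ℝ S), |inner ℝ (μ b) m| ≤ ‖m‖ := fun b m =>
    (abs_real_inner_le_norm _ _).trans
      (mul_le_of_le_one_left (norm_nonneg _) (hμ1 b))
  -- Cauchy–Schwarz makes `η * ‖m‖ - η * inner ℝ (μ b) m` nonnegative, and it vanishes at the
  -- posteriors of `e₀` where `b` is optimal.
  refine ⟨η, hη0, hηκ, fun b => WithLp.toLp 2 (U b) - η • μ b, fun e x b => ?_,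
    fun x b hb => normSup_le fun c => ?_, fun e x => ?_⟩
  · have h1 := le_normSup η (fun b => (WithLp.toLp 2 (U b) : EuclideanSpace ℝ S) - η • μ b)
      (posterior w e x) b
    rw [hinner] at h1
    have h2 := mul_le_mul_of_nonneg_left (le_of_abs_le (hbound b (posterior w e x))) hη0.le
    linarith
  · rw [hinner]
    rcases (hb c).lt_or_eq with h | h
    · have h1 := hgap x b c h
      have h2 := mul_le_mul_of_nonneg_left (neg_le_of_abs_le (hbound c (posterior w e₀ x))) hη0.le
      linarith
    · rw [hμ c x fun d => by rw [h]; exact hb d, h]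
      linarith
  · obtain ⟨r, -, hr⟩ := Finset.exists_max_image Finset.univ
      (fun b => signalPayoff w U e x b) Finset.univ_nonempty
    refine ⟨r, normSup_le fun b => ?_⟩
    rw [hinner]
    have h1 := hr b (Finset.mem_univ b)
    have h2 := mul_le_mul_of_nonneg_left (neg_le_of_abs_le (hbound b (posterior w e x))) hη0.le
    have h3 := mul_le_mul_of_nonneg_left (norm_posterior_le hw e x) hη0.le
    linarith

/-- A single agent's optimal experiment with separated best responses is optimal under a small
monotone cost, provided that full information is not much better. -/
theorem exists_small_monotone_cost [Nonempty B] [Nonempty X] {w : S → ℝ} (hw : ∀ s, 0 ≤ w s)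
    {U : B → S → ℝ} {e₀ : S → stdSimplex ℝ X} {r₀ : X → stdSimplex ℝ B}
    (hopt : ∀ x b, (r₀ x).1 b ≠ 0 →
      ∀ c, signalPayoff w U e₀ x c ≤ signalPayoff w U e₀ x b)
    (hsep : ∀ x x' b, posterior w e₀ x ≠ 0 → posterior w e₀ x' ≠ 0 →
      (∀ c, signalPayoff w U e₀ x c ≤ signalPayoff w U e₀ x b) →
      (∀ c, signalPayoff w U e₀ x' c ≤ signalPayoff w U e₀ x' b) → x = x')
    {ε : ℝ} (hε : 0 < ε)
    (hsmall : ∀ r : S → B, ∑ s, U (r s) s * w s ≤ planPayoff w U e₀ r₀ + ε / 2) :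
    ∃ C : (S → stdSimplex ℝ X) → ℝ≥0,
      (∀ e e', IsGarbling w e e' → C e' ≤ C e ∧ (¬ IsGarbling w e' e → C e' < C e)) ∧
      (∃ e, C e = 0) ∧ (∀ e, (C e : ℝ) ≤ ε) ∧
      ∀ e r, planPayoff w U e r - C e ≤ planPayoff w U e₀ r₀ - C e₀ := by
  classical
  have hM : 0 ≤ ∑ s, w s := Finset.sum_nonneg fun s _ => hw s
  -- The bound on `η` is chosen so that `2 * η * ∑ s, w s ≤ ε / 4`.
  obtain ⟨η, hη, hηκ, L, hL1, hL2, hL3⟩ := exists_support_vectors hw hsep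
    (κ := ε / 8 / (1 + ∑ s, w s)) (by positivity)
  set W : (S → stdSimplex ℝ X) → ℝ := fun e => ∑ x, normSup η L (posterior w e x) with hW
  have hWV : ∀ e r, planPayoff w U e r ≤ W e := by
    intro e r
    rw [planPayoff_eq]
    refine Finset.sum_le_sum fun x _ => ?_
    calc ∑ b, (r x).1 b * signalPayoff w U e x b
        ≤ ∑ b, (r x).1 b * normSup η L (posterior w e x) :=
          Finset.sum_le_sum fun b _ => mul_le_mul_of_nonneg_left (hL1 e x b) ((r x).2.1 b)
      _ = _ := by rw [← Finset.sum_mul, (r x).2.2, one_mul]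
  have hW0 : W e₀ = planPayoff w U e₀ r₀ := by
    refine le_antisymm ?_ (hWV _ _)
    rw [planPayoff_eq]
    refine Finset.sum_le_sum fun x _ => ?_
    calc normSup η L (posterior w e₀ x)
        = ∑ b, (r₀ x).1 b * normSup η L (posterior w e₀ x) := by
          rw [← Finset.sum_mul, (r₀ x).2.2, one_mul]
      _ ≤ _ := Finset.sum_le_sum fun b _ => by
          by_cases hb : (r₀ x).1 b = 0
          · simp [hb]
          · exact mul_le_mul_of_nonneg_left (hL2 x b (hopt x b hb)) ((r₀ x).2.1 b)
  -- Full information exceeds the value of `e₀` by at most `ε / 2`; the norm terms add at most `ε /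
  -- 4`.
  have hWle : ∀ e, W e ≤ W e₀ + 3 / 4 * ε := by
    intro e
    choose r hr using fun x => hL3 e x
    have hbest : ∀ s, ∃ b, ∀ c, U c s ≤ U b s := fun s => by
      obtain ⟨b, -, hb⟩ := Finset.exists_max_image Finset.univ (fun b => U b s)
        Finset.univ_nonempty
      exact ⟨b, fun c => hb c (Finset.mem_univ c)⟩
    choose t ht using hbest
    have h1 : W e ≤ ∑ x, ((∑ s, U (t s) s * (w s * (e s).1 x)) +
        2 * η * ∑ s, w s * (e s).1 x) := by
      refine Finset.sum_le_sum fun x _ => (hr x).trans ?_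
      gcongr with s
      exact Finset.sum_le_sum fun s _ =>
        mul_le_mul_of_nonneg_right (ht s _) (mul_nonneg (hw s) ((e s).2.1 x))
    have hx : ∀ f : S → ℝ, ∑ x, ∑ s, f s * (w s * (e s).1 x) = ∑ s, f s * w s := fun f => by
      rw [Finset.sum_comm]
      refine Finset.sum_congr rfl fun s _ => ?_
      rw [← Finset.mul_sum, ← Finset.mul_sum, (e s).2.2, mul_one]
    have hx1 := hx fun _ => 1
    simp only [one_mul] at hx1
    rw [Finset.sum_add_distrib, hx, ← Finset.mul_sum, hx1] at h1
    have h2 := hsmall t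
    have h3 : 2 * η * ∑ s, w s ≤ ε / 4 := by
      rw [le_div_iff₀ (by positivity)] at hηκ
      nlinarith
    linarith
  set e₁ : S → stdSimplex ℝ X := fun _ => stdSimplex.vertex (Classical.arbitrary X) with he₁
  have hbot : ∀ e, IsGarbling w e e₁ := fun e =>
    ⟨fun _ => stdSimplex.vertex (Classical.arbitrary X), fun x s _ => by
      rw [← Finset.mul_sum, (e s).2.2, mul_one]⟩
  have hmono := fun (e e' : S → stdSimplex ℝ X) (h : IsGarbling w e e') =>
    sum_normSup_posterior_mono hw hη L h
  -- `W e₀ - W e₁` need not be small, so below `W e₀` the slope is reduced to `l`, which turns this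
  -- drop into at most `ε / 4`.
  set l : ℝ := min 1 (ε / 4 / (1 + |W e₀ - W e₁|)) with hl
  have hl0 : 0 < l := lt_min one_pos (by positivity)
  have hl1 : l * (W e₀ - W e₁) ≤ ε / 4 := by
    have h1 : l ≤ ε / 4 / (1 + |W e₀ - W e₁|) := min_le_right _ _
    rw [le_div_iff₀ (by positivity)] at h1
    have h2 := mul_le_mul_of_nonneg_left (le_abs_self (W e₀ - W e₁)) hl0.le
    linarith
  -- `T` is strictly increasing, lies above the identity and vanishes at 0. Hence payoff minus `T (W
  -- e - W e₀)` never exceeds `W e₀`, with equality at `e₀`.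
  set T : ℝ → ℝ := fun t => max t (l * t) with hT
  have hTm : StrictMono T := fun s t h => max_lt_max h (mul_lt_mul_of_pos_left h hl0)
  have hc0 : ∀ e, 0 ≤ T (W e - W e₀) - T (W e₁ - W e₀) := fun e =>
    sub_nonneg.2 (hTm.monotone (sub_le_sub_right (hmono e e₁ (hbot e)).1 _))
  refine ⟨fun e => ⟨T (W e - W e₀) - T (W e₁ - W e₀), hc0 e⟩, fun e e' h => ⟨?_, fun hn => ?_⟩,
    ⟨e₁, ?_⟩, fun e => ?_, fun e r => ?_⟩
  · exact sub_le_sub_right (hTm.monotone (sub_le_sub_right (hmono e e' h).1 _)) _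
  · exact sub_lt_sub_right (hTm (sub_lt_sub_right ((hmono e e' h).2 hn) _)) _
  · exact Subtype.ext (sub_self _)
  · change T (W e - W e₀) - T (W e₁ - W e₀) ≤ ε
    have h1 : T (W e - W e₀) ≤ 3 / 4 * ε := by
      have hq := hWle e
      refine max_le (by linarith) ?_
      have hl2 : l ≤ 1 := min_le_left _ _
      rcases le_total 0 (W e - W e₀) with h | h
      · nlinarith
      · nlinarith
    have h2 : l * (W e₁ - W e₀) ≤ T (W e₁ - W e₀) := le_max_right _ _
    linarith
  · change planPayoff w U e r - (T (W e - W e₀) - T (W e₁ - W e₀)) ≤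
      planPayoff w U e₀ r₀ - (T (W e₀ - W e₀) - T (W e₁ - W e₀))
    have h1 : W e - W e₀ ≤ T (W e - W e₀) := le_max_left _ _
    have h2 : T (W e₀ - W e₀) = 0 := by simp [hT]
    have h3 := hWV e r
    linarith

end CostConstruction

/-! ### Action profiles, laws of play and payoffs with the signals summed out. -/

section Profiles

variable {I : Type*} {A : I → Type*} [DecidableEq I]

@[simp] theorem profile_same (i : I) (b : A i) (m : Others A i) : profile i b m i = b := by
  simp [profile]

@[simp] theorem profile_other (i : I) (b : A i) (m : Others A i) (j : {j : I // j ≠ i}) :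
    profile i b m j = m j := by
  simp [profile, j.2]

theorem profile_eq_update (i : I) (b : A i) (a : ∀ j, A j) :
    profile i b (fun j => a j) = Function.update a i b := by
  funext j
  by_cases h : j = i
  · subst h
    simp
  · rw [Function.update_of_ne h]
    exact profile_other i b (fun j => a j) ⟨j, h⟩

variable [Fintype I]

theorem sum_profile [∀ i, Fintype (A i)] (i : I) (f : (∀ j, A j) → ℝ) :
    ∑ a, f a = ∑ b, ∑ m, f (profile i b m) := by
  rw [← (Equiv.piSplitAt i A).symm.sum_comp, Fintype.sum_prod_type]
  rfl

theorem prod_erase_profile (i : I) (f : ∀ j, A j → ℝ) (b : A i) (m : Others A i) :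
    ∏ j ∈ Finset.univ.erase i, f j (profile i b m j) =
      ∏ j : {j : I // j ≠ i}, f j (m j) := by
  rw [Finset.prod_subtype (p := fun j => j ≠ i) (F := inferInstance) (Finset.univ.erase i)
    (by simp)]
  simp only [profile_other]

theorem prod_profile (i : I) (f : ∀ j, A j → ℝ) (b : A i) (m : Others A i) :
    ∏ j, f j (profile i b m j) = f i b * ∏ j : {j : I // j ≠ i}, f j (m j) := by
  rw [← Finset.mul_prod_erase _ _ (Finset.mem_univ i), prod_erase_profile, profile_same]

end Profiles

section PlayLaw

variable {Z Θ X B : Type*} [Fintype X] [Fintype B]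

/-- The law of the action induced by an experiment and an action plan. -/
noncomputable def playLaw (e : Experiment Z Θ X) (s : ActionPlan X B) (z : Z) (θ : Θ) (b : B) :
    ℝ :=
  ∑ x, (s x).1 b * (e z θ).1 x

theorem playLaw_nonneg (e : Experiment Z Θ X) (s : ActionPlan X B) (z : Z) (θ : Θ) (b : B) :
    0 ≤ playLaw e s z θ b :=
  Finset.sum_nonneg fun x _ => mul_nonneg ((s x).2.1 b) ((e z θ).2.1 x)

theorem sum_playLaw (e : Experiment Z Θ X) (s : ActionPlan X B) (z : Z) (θ : Θ) :
    ∑ b, playLaw e s z θ b = 1 := by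
  unfold playLaw
  rw [Finset.sum_comm]
  simp only [← Finset.sum_mul, (s _).2.2, one_mul, (e z θ).2.2]

end PlayLaw

section Payoffs

variable {I Θ : Type*} {A : I → Type*} [Fintype I] [DecidableEq I] [Fintype Θ]
  [∀ i, Fintype (A i)]

/-- The payoff of the action `b` at `(z, θ)` when the others' actions are drawn independently
from the laws `K j z θ`. -/
noncomputable def BaseGame.statePayoff {Z : Type*} (G : BaseGame I Θ A) (i : I)
    (K : ∀ j, Z → Θ → A j → ℝ) (b : A i) (z : Z) (θ : Θ) : ℝ :=
  ∑ m : Others A i, G.u i (profile i b m) θ * ∏ j : {j : I // j ≠ i}, K j z θ (m j)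

/-- Signals are independent across players given `(z, θ)`, so strategies matter only through the
action laws they induce at each `(z, θ)`. -/
theorem BaseGame.grossPayoff_eq (G : BaseGame I Θ A) (T : Technology I Θ A) (i : I)
    (e : Experiment T.Z Θ (T.X i)) (s : ActionPlan (T.X i) (A i))
    (ξ : ∀ j, Experiment T.Z Θ (T.X j)) (σ : ∀ j, ActionPlan (T.X j) (A j)) :
    G.grossPayoff T i e s ξ σ = ∑ z, ∑ θ, ∑ b, playLaw e s z θ b *
      (G.statePayoff i (fun j => playLaw (ξ j) (σ j)) b z θ * ((T.ζ θ).1 z * G.prior.1 θ)) := by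
  have h1 : ∀ (a : ∀ j, A j) (z : T.Z) (θ : Θ), ∑ x : (∀ j, T.X j),
      G.u i a θ * (s (x i)).1 (a i) * (e z θ).1 (x i) *
      (∏ j ∈ Finset.univ.erase i, (σ j (x j)).1 (a j) * (ξ j z θ).1 (x j)) *
      (T.ζ θ).1 z * G.prior.1 θ =
      playLaw e s z θ (a i) * (∏ j ∈ Finset.univ.erase i, playLaw (ξ j) (σ j) z θ (a j)) *
        (G.u i a θ * ((T.ζ θ).1 z * G.prior.1 θ)) := by
    intro a z θ
    -- The deviator's factor is put at coordinate `i`, so that one expansion of a product of sums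
    -- covers all players.
    set F : ∀ j, T.X j → ℝ := Function.update
      (fun j y => (σ j y).1 (a j) * (ξ j z θ).1 y) i (fun y => (s y).1 (a i) * (e z θ).1 y)
      with hF
    have hFi : F i = fun y => (s y).1 (a i) * (e z θ).1 y := Function.update_self _ _ _
    have hFj : ∀ j ∈ Finset.univ.erase i, F j = fun y => (σ j y).1 (a j) * (ξ j z θ).1 y :=
      fun j hj => Function.update_of_ne (Finset.ne_of_mem_erase hj) _ _
    have h2 : playLaw e s z θ (a i) *
        (∏ j ∈ Finset.univ.erase i, playLaw (ξ j) (σ j) z θ (a j)) = ∏ j, ∑ y, F j y := by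
      rw [← Finset.mul_prod_erase _ _ (Finset.mem_univ i), hFi]
      congr 1
      exact Finset.prod_congr rfl fun j hj => by rw [hFj j hj]; rfl
    rw [h2, Fintype.prod_sum, Finset.sum_mul]
    refine Finset.sum_congr rfl fun x _ => ?_
    have h3 : ∏ j ∈ Finset.univ.erase i, F j (x j) =
        ∏ j ∈ Finset.univ.erase i, (σ j (x j)).1 (a j) * (ξ j z θ).1 (x j) :=
      Finset.prod_congr rfl fun j hj => by rw [hFj j hj]
    rw [← Finset.mul_prod_erase _ _ (Finset.mem_univ i), hFi, h3]
    ring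
  unfold BaseGame.grossPayoff
  calc _ = ∑ a : (∀ j, A j), ∑ z, ∑ θ, playLaw e s z θ (a i) *
        (∏ j ∈ Finset.univ.erase i, playLaw (ξ j) (σ j) z θ (a j)) *
        (G.u i a θ * ((T.ζ θ).1 z * G.prior.1 θ)) := by
        refine Finset.sum_congr rfl fun a _ => ?_
        rw [Finset.sum_comm]
        refine Finset.sum_congr rfl fun z _ => ?_
        rw [Finset.sum_comm]
        exact Finset.sum_congr rfl fun θ _ => h1 a z θ
    _ = ∑ z, ∑ θ, ∑ a : (∀ j, A j), playLaw e s z θ (a i) *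
        (∏ j ∈ Finset.univ.erase i, playLaw (ξ j) (σ j) z θ (a j)) *
        (G.u i a θ * ((T.ζ θ).1 z * G.prior.1 θ)) := by
        rw [Finset.sum_comm]
        exact Finset.sum_congr rfl fun z _ => Finset.sum_comm
    _ = _ := by
        refine Finset.sum_congr rfl fun z _ => Finset.sum_congr rfl fun θ _ => ?_
        rw [sum_profile i]
        refine Finset.sum_congr rfl fun b _ => ?_
        unfold BaseGame.statePayoff
        rw [Finset.sum_mul, Finset.mul_sum]
        refine Finset.sum_congr rfl fun m _ => ?_
        rw [prod_erase_profile i (fun j => playLaw (ξ j) (σ j) z θ), profile_same]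
        ring

theorem BaseGame.outcomeOf_eq (G : BaseGame I Θ A) (T : Technology I Θ A)
    (ξ : ∀ i, T.feasible i) (σ : ∀ i, ActionPlan (T.X i) (A i)) (a : ∀ i, A i) (θ : Θ) :
    G.outcomeOf T ξ σ (a, θ) =
      ∑ z, (∏ j, playLaw (ξ j).1 (σ j) z θ (a j)) * ((T.ζ θ).1 z * G.prior.1 θ) := by
  unfold BaseGame.outcomeOf
  rw [Finset.sum_comm]
  refine Finset.sum_congr rfl fun z _ => ?_
  unfold playLaw
  rw [Fintype.prod_sum, Finset.sum_mul]
  exact Finset.sum_congr rfl fun x _ => by ring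

/-- Player `i`'s payoff from `b` under a joint law of actions and states that is a mixture of
products, on the event that the `i`-th coordinate is drawn as `c`. -/
theorem BaseGame.expectedUtility_profile {Z : Type*} [Fintype Z] (G : BaseGame I Θ A) (i : I)
    (K : ∀ j, Z → Θ → A j → ℝ) (t : Z → Θ → ℝ) (v : Z → Θ → ℝ) (m : Others A i × Θ → ℝ)
    (hm : ∀ y, m y = ∑ z, v z y.2 * t z y.2 * ∏ j : {j : I // j ≠ i}, K j z y.2 (y.1 j))
    (b : A i) :
    G.expectedUtility i b m = ∑ z, ∑ θ, v z θ * (G.statePayoff i K b z θ * t z θ) := by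
  unfold BaseGame.expectedUtility BaseGame.statePayoff
  simp only [hm, Finset.mul_sum, Finset.sum_mul]
  rw [Finset.sum_comm' (t' := Finset.univ) (s' := fun _ => Finset.univ) (by simp)]
  rw [Finset.sum_comm (s := (Finset.univ : Finset Z))]
  refine Finset.sum_congr rfl fun θ _ => ?_
  rw [Finset.sum_comm]
  exact Finset.sum_congr rfl fun z _ => Finset.sum_congr rfl fun y _ => by ring

theorem actionProb_of_mixture {Z : Type*} [Fintype Z] {q : (∀ i, A i) × Θ → ℝ} {i : I}
    {c : A i} (K : ∀ j, Z → Θ → A j → ℝ) (hK : ∀ j z θ, ∑ b, K j z θ b = 1) (t : Z → Θ → ℝ)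
    (v : Z → Θ → ℝ)
    (hm : ∀ (m : Others A i) θ, q (profile i c m, θ) =
      ∑ z, v z θ * t z θ * ∏ j : {j : I // j ≠ i}, K j z θ (m j)) :
    actionProb q i c = ∑ z, ∑ θ, v z θ * t z θ := by
  unfold actionProb
  simp only [hm]
  rw [Finset.sum_comm, Finset.sum_comm (s := (Finset.univ : Finset Z))]
  refine Finset.sum_congr rfl fun θ _ => ?_
  rw [Finset.sum_comm]
  refine Finset.sum_congr rfl fun z _ => ?_
  rw [← Finset.mul_sum, ← Fintype.prod_sum]
  simp only [hK, Finset.prod_const_one, mul_one]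

theorem BaseGame.sum_mul_statePayoff {Z : Type*} (G : BaseGame I Θ A) (i : I)
    (K : ∀ j, Z → Θ → A j → ℝ) (z : Z) (θ : Θ) :
    ∑ b, K i z θ b * G.statePayoff i K b z θ = ∑ a, G.u i a θ * ∏ j, K j z θ (a j) := by
  rw [sum_profile i]
  refine Finset.sum_congr rfl fun b _ => ?_
  unfold BaseGame.statePayoff
  rw [Finset.mul_sum]
  refine Finset.sum_congr rfl fun m _ => ?_
  rw [prod_profile i (fun j => K j z θ)]
  ring

theorem BaseGame.expectedUtility_const_mul (G : BaseGame I Θ A) (i : I) (b : A i) (c : ℝ)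
    (m : Others A i × Θ → ℝ) :
    G.expectedUtility i b (fun y => c * m y) = c * G.expectedUtility i b m := by
  simp only [BaseGame.expectedUtility, Finset.mul_sum]
  exact Finset.sum_congr rfl fun _ _ => Finset.sum_congr rfl fun _ _ => by ring

/-- The event that player `i` plays `c`, as an unnormalized law of the others' actions and the
payoff state. -/
def slice (q : (∀ i, A i) × Θ → ℝ) (i : I) (c : A i) : Others A i × Θ → ℝ :=
  fun y => q (profile i c y.1, y.2)

theorem actionProb_nonneg {q : (∀ i, A i) × Θ → ℝ} (hq : ∀ y, 0 ≤ q y) (i : I) (c : A i) :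
    0 ≤ actionProb q i c :=
  Finset.sum_nonneg fun _ _ => Finset.sum_nonneg fun _ _ => hq _

/-- For an action of probability zero the slice vanishes as well, so the junk value of the quotient
does no harm. -/
theorem actionProb_mul_condBelief {q : (∀ i, A i) × Θ → ℝ} (hq : ∀ y, 0 ≤ q y) (i : I)
    (c : A i) (y : Others A i × Θ) :
    slice q i c y = actionProb q i c * condBelief q i c y := by
  by_cases h : actionProb q i c = 0
  · rw [h, zero_mul]
    have h1 : ∑ m : Others A i, ∑ θ, q (profile i c m, θ) = 0 := h
    have h2 := (Finset.sum_eq_zero_iff_of_nonneg fun m _ =>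
      Finset.sum_nonneg fun θ _ => hq (profile i c m, θ)).1 h1 y.1 (Finset.mem_univ _)
    exact (Finset.sum_eq_zero_iff_of_nonneg fun θ _ => hq (profile i c y.1, θ)).1 h2 y.2
      (Finset.mem_univ _)
  · exact (mul_div_cancel₀ _ h).symm

theorem BaseGame.expectedUtility_slice (G : BaseGame I Θ A) {q : (∀ i, A i) × Θ → ℝ}
    (hq : ∀ y, 0 ≤ q y) (i : I) (b c : A i) :
    G.expectedUtility i b (slice q i c) =
      actionProb q i c * G.expectedUtility i b (condBelief q i c) := by
  rw [← G.expectedUtility_const_mul]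
  congr 1
  funext y
  exact actionProb_mul_condBelief hq i c y

theorem BaseGame.mem_bestResponses_condBelief (G : BaseGame I Θ A) {q : (∀ i, A i) × Θ → ℝ}
    (hq : ∀ y, 0 ≤ q y) {i : I} {c : A i} (hc : 0 < actionProb q i c) (b : A i) :
    b ∈ G.bestResponses i (condBelief q i c) ↔
      ∀ d, G.expectedUtility i d (slice q i c) ≤ G.expectedUtility i b (slice q i c) := by
  simp only [G.expectedUtility_slice hq, mul_le_mul_iff_right₀ hc]
  rfl

theorem BaseGame.obedience_iff (G : BaseGame I Θ A) (q : (∀ i, A i) × Θ → ℝ) (i : I)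
    (c b : A i) :
    0 ≤ ∑ am : Others A i, ∑ θ : Θ,
      (G.u i (profile i c am) θ - G.u i (profile i b am) θ) * q (profile i c am, θ) ↔
    G.expectedUtility i b (slice q i c) ≤ G.expectedUtility i c (slice q i c) := by
  simp only [BaseGame.expectedUtility, sub_mul, Finset.sum_sub_distrib, sub_nonneg]
  rfl

end Payoffs

/-! ### Composition of kernels, and cancellation when signals are merged. -/

section KernelComp

variable {X Y : Type*} [Fintype X] [Fintype Y]

/-- The image of a probability vector under a Markov kernel. -/
noncomputable def kernelComp (k : X → stdSimplex ℝ Y) (p : stdSimplex ℝ X) : stdSimplex ℝ Y :=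
  ⟨fun y => ∑ x, (k x).1 y * p.1 x,
    fun y => Finset.sum_nonneg fun x _ => mul_nonneg ((k x).2.1 y) (p.2.1 x), by
      rw [Finset.sum_comm]
      simp only [← Finset.sum_mul, (k _).2.2, one_mul, p.2.2]⟩

theorem kernelComp_apply (k : X → stdSimplex ℝ Y) (p : stdSimplex ℝ X) (y : Y) :
    (kernelComp k p).1 y = ∑ x, (k x).1 y * p.1 x := rfl

theorem sum_kernelComp_mul (k : X → stdSimplex ℝ Y) (p : stdSimplex ℝ X) (f : Y → ℝ) :
    ∑ y, (kernelComp k p).1 y * f y = ∑ x, p.1 x * ∑ y, (k x).1 y * f y := by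
  simp only [kernelComp_apply, Finset.sum_mul, Finset.mul_sum]
  rw [Finset.sum_comm]
  exact Finset.sum_congr rfl fun x _ => Finset.sum_congr rfl fun y _ => by ring

theorem sum_vertex_mul [DecidableEq X] (x : X) (f : X → ℝ) :
    ∑ y, (stdSimplex.vertex (S := ℝ) x).1 y * f y = f x := by
  rw [Finset.sum_eq_single x]
  · simp
  · intro y _ hy
    simp [hy]
  · simp

theorem vertex_apply [DecidableEq X] (x y : X) :
    (stdSimplex.vertex (S := ℝ) x).1 y = if x = y then 1 else 0 := by
  simp [Pi.single_apply, eq_comm]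

theorem playLaw_eq {Z Θ : Type*} (e : Experiment Z Θ X) (s : ActionPlan X Y) (z : Z) (θ : Θ)
    (b : Y) : playLaw e s z θ b = (kernelComp s (e z θ)).1 b := rfl

theorem sum_sum_sum_mul {C Z Θ : Type*} [Fintype C] [Fintype Z] [Fintype Θ] (k : C → ℝ)
    (K : C → Z → Θ → ℝ) (h : Z → Θ → ℝ) :
    ∑ z, ∑ θ, (∑ c, k c * K c z θ) * h z θ = ∑ c, k c * ∑ z, ∑ θ, K c z θ * h z θ := by
  simp only [Finset.mul_sum, Finset.sum_mul]
  rw [Finset.sum_comm (s := (Finset.univ : Finset C))]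
  refine Finset.sum_congr rfl fun z _ => ?_
  rw [Finset.sum_comm (s := (Finset.univ : Finset C))]
  exact Finset.sum_congr rfl fun θ _ => Finset.sum_congr rfl fun c _ => by ring

/-- Merging two terms of strictly opposite signs decreases the sum of absolute values. -/
theorem abs_sum_lt_sum_abs_of_neg_of_pos {C : Type*} {s : Finset C} {f : C → ℝ} {a b : C}
    (ha : a ∈ s) (hb : b ∈ s) (hfa : f a < 0) (hfb : 0 < f b) :
    |∑ c ∈ s, f c| < ∑ c ∈ s, |f c| := by
  rw [abs_lt]
  constructor
  · rw [← Finset.sum_neg_distrib]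
    exact Finset.sum_lt_sum (fun c _ => neg_abs_le _) ⟨b, hb, by linarith [abs_of_pos hfb]⟩
  · exact Finset.sum_lt_sum (fun c _ => le_abs_self _) ⟨a, ha, by linarith [abs_of_neg hfa]⟩

/-- The values at `a` and `b` have opposite signs and fall into one fibre, where they partly cancel.
-/
theorem sum_abs_fiberwise_lt {C : Type*} [Fintype C] [DecidableEq X] (j : C → X) (f : C → ℝ)
    {a b : C} (hj : j a = j b) (hfa : f a < 0) (hfb : 0 < f b) :
    ∑ x, |∑ c with j c = x, f c| < ∑ c, |f c| := by
  rw [← Finset.sum_fiberwise Finset.univ j fun c => |f c|]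
  refine Finset.sum_lt_sum (fun x _ => Finset.abs_sum_le_sum_abs _ _)
    ⟨j a, Finset.mem_univ _, abs_sum_lt_sum_abs_of_neg_of_pos (a := a) (b := b) ?_ ?_ hfa hfb⟩
  · simp
  · simp [hj]

end KernelComp

/-! ### Equilibrium outcomes are separated Bayes correlated equilibria. -/

section Necessity

variable {I Θ : Type*} {A : I → Type*} [Fintype I] [DecidableEq I] [Fintype Θ]
  [∀ i, Fintype (A i)]

theorem BaseGame.outcomeOf_mem_outcomes (G : BaseGame I Θ A) (T : Technology I Θ A)
    (ξ : ∀ i, T.feasible i) (σ : ∀ i, ActionPlan (T.X i) (A i)) :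
    G.outcomeOf T ξ σ ∈ G.outcomes := by
  have hsum : ∀ θ, ∑ a, G.outcomeOf T ξ σ (a, θ) = G.prior.1 θ := by
    intro θ
    simp only [BaseGame.outcomeOf_eq]
    rw [Finset.sum_comm]
    have h : ∀ z, ∑ a : (∀ j, A j), (∏ j, playLaw (ξ j).1 (σ j) z θ (a j)) = 1 := fun z => by
      rw [← Fintype.prod_sum]
      simp only [sum_playLaw, Finset.prod_const_one]
    simp only [← Finset.sum_mul, h, one_mul]
    rw [(T.ζ θ).2.2, one_mul]
  refine ⟨⟨?_, ?_⟩, hsum⟩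
  · rintro ⟨a, θ⟩
    rw [BaseGame.outcomeOf_eq]
    exact Finset.sum_nonneg fun z _ => mul_nonneg
      (Finset.prod_nonneg fun j _ => playLaw_nonneg _ _ _ _ _)
      (mul_nonneg ((T.ζ θ).2.1 z) (G.prior_pos θ).le)
  · rw [Fintype.sum_prod_type_right]
    simp only [hsum]
    exact G.prior.2.2

theorem BaseGame.slice_outcomeOf (G : BaseGame I Θ A) (T : Technology I Θ A)
    (ξ : ∀ i, T.feasible i) (σ : ∀ i, ActionPlan (T.X i) (A i)) (i : I) (c : A i)
    (y : Others A i × Θ) :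
    slice (G.outcomeOf T ξ σ) i c y = ∑ z, playLaw (ξ i).1 (σ i) z y.2 c *
      ((T.ζ y.2).1 z * G.prior.1 y.2) *
        ∏ j : {j : I // j ≠ i}, playLaw (ξ j).1 (σ j) z y.2 (y.1 j) := by
  unfold slice
  rw [BaseGame.outcomeOf_eq]
  refine Finset.sum_congr rfl fun z _ => ?_
  rw [prod_profile i (fun j => playLaw (ξ j).1 (σ j) z y.2)]
  ring

theorem BaseGame.actionProb_outcomeOf (G : BaseGame I Θ A) (T : Technology I Θ A)
    (ξ : ∀ i, T.feasible i) (σ : ∀ i, ActionPlan (T.X i) (A i)) (i : I) (c : A i) :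
    actionProb (G.outcomeOf T ξ σ) i c = ∑ z, ∑ θ, playLaw (ξ i).1 (σ i) z θ c *
      ((T.ζ θ).1 z * G.prior.1 θ) :=
  actionProb_of_mixture (fun j => playLaw (ξ j).1 (σ j)) (fun _ z θ => sum_playLaw _ _ z θ)
    _ _ fun m θ => G.slice_outcomeOf T ξ σ i c (m, θ)

/-- The experiment that reports only the image under `j` of the recommended action. -/
noncomputable def relabel {Z X B : Type*} [Fintype X] [Fintype B] [DecidableEq X]
    (e : Experiment Z Θ X) (s : ActionPlan X B) (j : B → X) : Experiment Z Θ X :=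
  fun z θ => kernelComp (fun c => stdSimplex.vertex (j c)) (kernelComp s (e z θ))

theorem Technology.blackwellDominates_relabel (T : Technology I Θ A) {i : I}
    [DecidableEq (T.X i)] (e : Experiment T.Z Θ (T.X i)) (s : ActionPlan (T.X i) (A i))
    (j : A i → T.X i) : T.BlackwellDominates e (relabel e s j) := by
  refine ⟨fun y => kernelComp (fun c => stdSimplex.vertex (j c)) (s y), fun x θ z _ => ?_⟩
  simp only [relabel, kernelComp_apply, Finset.mul_sum, Finset.sum_mul]
  rw [Finset.sum_comm]
  exact Finset.sum_congr rfl fun y _ => Finset.sum_congr rfl fun c _ => by ring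

/-- The master deviation: `m` coarsens the recommendations, `ι` encodes the result as a signal, `r`
is the response. The new experiment is a garbling, hence no costlier; if no payoff is lost, its cost
cannot be strictly lower, so it must be equally informative. -/
theorem BaseGame.IsEquilibrium.sum_expectedUtility_relabel_le {G : BaseGame I Θ A}
    {T : Technology I Θ A} (hT : T.IsUnconstrainedRI) {ξ : ∀ i, T.feasible i}
    {σ : ∀ i, ActionPlan (T.X i) (A i)} (heq : G.IsEquilibrium T ξ σ) {i : I}
    [DecidableEq (T.X i)] {ι : A i → T.X i} (hι : Function.Injective ι) (m r : A i → A i) :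
    ∑ c, G.expectedUtility i (r (m c)) (slice (G.outcomeOf T ξ σ) i c) ≤
        ∑ c, G.expectedUtility i c (slice (G.outcomeOf T ξ σ) i c) ∧
      (∑ c, G.expectedUtility i c (slice (G.outcomeOf T ξ σ) i c) ≤
          ∑ c, G.expectedUtility i (r (m c)) (slice (G.outcomeOf T ξ σ) i c) →
        T.BlackwellDominates (relabel (ξ i).1 (σ i) fun c => ι (m c)) (ξ i).1) := by
  classical
  by_cases hA : Nonempty (A i)
  swap
  -- Without actions there can be no pair `(z, θ)`, since a law of play would have total mass 1 on
  -- an empty set.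
  · rw [not_nonempty_iff] at hA
    refine ⟨by simp, fun _ => ?_⟩
    by_cases hZ : Nonempty (T.Z × Θ)
    · obtain ⟨z, θ⟩ := hZ
      have := sum_playLaw (ξ i).1 (σ i) z θ
      simp at this
    · rw [not_nonempty_iff] at hZ
      exact ⟨fun x => stdSimplex.vertex x, fun x θ z => (hZ.false (z, θ)).elim⟩
  set e' : T.feasible i := ⟨relabel (ξ i).1 (σ i) fun c => ι (m c), by
    simp only [(hT i).1, Set.mem_univ]⟩ with he'
  set s' : ActionPlan (T.X i) (A i) :=
    fun x => stdSimplex.vertex (r (Function.invFun ι x)) with hs'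
  have hpay : ∀ r' : A i → A i, ∑ z, ∑ θ, ∑ c, playLaw (ξ i).1 (σ i) z θ c *
      (G.statePayoff i (fun j => playLaw (ξ j).1 (σ j)) (r' c) z θ *
        ((T.ζ θ).1 z * G.prior.1 θ)) =
      ∑ c, G.expectedUtility i (r' c) (slice (G.outcomeOf T ξ σ) i c) := by
    intro r'
    have h : ∀ c, G.expectedUtility i (r' c) (slice (G.outcomeOf T ξ σ) i c) = _ := fun c =>
      G.expectedUtility_profile i (fun j => playLaw (ξ j).1 (σ j))
        (fun z θ => (T.ζ θ).1 z * G.prior.1 θ) (fun z θ => playLaw (ξ i).1 (σ i) z θ c)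
        _ (G.slice_outcomeOf T ξ σ i c) (r' c)
    simp only [h]
    rw [Finset.sum_comm (s := (Finset.univ : Finset (A i)))]
    refine Finset.sum_congr rfl fun z _ => ?_
    rw [Finset.sum_comm (s := (Finset.univ : Finset (A i)))]
  have h1 : G.grossPayoff T i (ξ i).1 (σ i) (fun j => (ξ j).1) σ =
      ∑ c, G.expectedUtility i c (slice (G.outcomeOf T ξ σ) i c) := by
    rw [G.grossPayoff_eq]
    exact hpay id
  have h2 : G.grossPayoff T i e'.1 s' (fun j => (ξ j).1) σ =
      ∑ c, G.expectedUtility i (r (m c)) (slice (G.outcomeOf T ξ σ) i c) := by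
    rw [G.grossPayoff_eq, ← hpay fun c => r (m c)]
    refine Finset.sum_congr rfl fun z _ => Finset.sum_congr rfl fun θ _ => ?_
    simp only [playLaw_eq]
    rw [sum_kernelComp_mul]
    simp only [hs', he', sum_vertex_mul, relabel]
    rw [sum_kernelComp_mul]
    simp only [sum_vertex_mul, Function.leftInverse_invFun hι (m _)]
  have h3 := heq i e' s'
  have h4 := (hT i).2 (ξ i) e' (T.blackwellDominates_relabel _ _ _)
  rw [h1, h2] at h3
  have h5 : (T.cost i e' : ℝ) ≤ T.cost i (ξ i) := h4.1
  refine ⟨by linarith, fun hle => ?_⟩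
  by_contra hn
  have h6 : (T.cost i e' : ℝ) < T.cost i (ξ i) := h4.2 hn
  linarith

/-- An experiment that merges two recommendations with distinct beliefs loses information. -/
theorem BaseGame.not_blackwellDominates_relabel (G : BaseGame I Θ A) (T : Technology I Θ A)
    (ξ : ∀ i, T.feasible i) (σ : ∀ i, ActionPlan (T.X i) (A i)) {i : I} [DecidableEq (T.X i)]
    {a b : A i} (ha : 0 < actionProb (G.outcomeOf T ξ σ) i a)
    (hb : 0 < actionProb (G.outcomeOf T ξ σ) i b) {y : Others A i × Θ}
    (hab : condBelief (G.outcomeOf T ξ σ) i a y < condBelief (G.outcomeOf T ξ σ) i b y)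
    {j : A i → T.X i} (hj : j a = j b) :
    ¬ T.BlackwellDominates (relabel (ξ i).1 (σ i) j) (ξ i).1 := by
  classical
  rintro ⟨g, hg⟩
  obtain ⟨t, hat, htb⟩ := exists_between hab
  have hq := (G.outcomeOf_mem_outcomes T ξ σ).1.1
  set q := G.outcomeOf T ξ σ with hqdef
  -- The resulting `Λ` is the probability of a signal together with the event `y`, minus `t` times
  -- the probability of the signal. Its sign compares the posterior probability of `y` with `t`,
  -- which lies strictly between the values at `a` and `b`.
  set h : T.Z → Θ → ℝ := fun z θ => ((T.ζ θ).1 z * G.prior.1 θ) *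
    ((if θ = y.2 then ∏ k : {k : I // k ≠ i}, playLaw (ξ k).1 (σ k) z θ (y.1 k) else 0) - t)
    with hh
  set Λ : Experiment T.Z Θ (T.X i) → T.X i → ℝ :=
    fun e x => ∑ z, ∑ θ, (e z θ).1 x * h z θ with hΛ
  set l : A i → ℝ := fun c => actionProb q i c * (condBelief q i c y - t) with hl
  have hl' : ∀ c, ∑ z, ∑ θ, playLaw (ξ i).1 (σ i) z θ c * h z θ = l c := by
    intro c
    simp only [hl, mul_sub]
    rw [← actionProb_mul_condBelief hq, G.slice_outcomeOf, G.actionProb_outcomeOf,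
      Finset.sum_mul, ← Finset.sum_sub_distrib]
    refine Finset.sum_congr rfl fun z _ => ?_
    have h1 : playLaw (ξ i).1 (σ i) z y.2 c * ((T.ζ y.2).1 z * G.prior.1 y.2) *
        ∏ k : {k : I // k ≠ i}, playLaw (ξ k).1 (σ k) z y.2 (y.1 k) =
        ∑ θ, if θ = y.2 then playLaw (ξ i).1 (σ i) z θ c * ((T.ζ θ).1 z * G.prior.1 θ) *
        ∏ k : {k : I // k ≠ i}, playLaw (ξ k).1 (σ k) z θ (y.1 k) else 0 := by
      rw [Finset.sum_ite_eq' Finset.univ y.2, if_pos (Finset.mem_univ _)]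
    rw [h1, Finset.sum_mul, ← Finset.sum_sub_distrib]
    refine Finset.sum_congr rfl fun θ _ => ?_
    simp only [hh]
    split_ifs <;> ring
  have hle : ∀ x, (∑ w, (g w).1 x • Λ (relabel (ξ i).1 (σ i) j) w) = Λ (ξ i).1 x := by
    intro x
    simp only [hΛ, smul_eq_mul, Finset.mul_sum]
    rw [Finset.sum_comm]
    refine Finset.sum_congr rfl fun z _ => ?_
    rw [Finset.sum_comm]
    refine Finset.sum_congr rfl fun θ _ => ?_
    rcases ((T.ζ θ).2.1 z).eq_or_lt with h0 | h0
    · have : h z θ = 0 := by simp only [hh, ← h0]; simp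
      simp [this]
    · rw [hg x θ z h0, Finset.sum_mul]
      exact Finset.sum_congr rfl fun w _ => by ring
  have hrel : ∀ x, Λ (relabel (ξ i).1 (σ i) j) x = ∑ c with j c = x, l c := by
    intro x
    rw [Finset.sum_filter]
    have h1 : Λ (relabel (ξ i).1 (σ i) j) x = _ := sum_sum_sum_mul
      (fun c => (stdSimplex.vertex (S := ℝ) (j c)).1 x)
      (fun c z θ => playLaw (ξ i).1 (σ i) z θ c) h
    rw [h1]
    refine Finset.sum_congr rfl fun c _ => ?_
    rw [hl', vertex_apply, ite_mul, one_mul, zero_mul]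
  have hplay : ∀ c, l c = ∑ x, ((σ i) x).1 c • Λ (ξ i).1 x := by
    intro c
    rw [← hl']
    exact sum_sum_sum_mul (fun x => (σ i x).1 c) (fun x z θ => ((ξ i).1 z θ).1 x) h
  -- The sum of `|Λ|` cannot increase under garbling. It strictly falls from recommendations to
  -- merged recommendations, so recovering the original experiment from the latter is impossible.
  have h1 : ∑ x, |Λ (ξ i).1 x| ≤ ∑ x, |Λ (relabel (ξ i).1 (σ i) j) x| := by
    have := sum_sublinear_garbling_le (φ := fun t : ℝ => |t|) abs_zero abs_add_le
      (fun c v hc => by rw [smul_eq_mul, abs_mul, abs_of_nonneg hc]) g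
      (Λ (relabel (ξ i).1 (σ i) j))
    simpa only [hle] using this
  have h2 : ∑ x, |Λ (relabel (ξ i).1 (σ i) j) x| < ∑ c, |l c| := by
    simp only [hrel]
    exact sum_abs_fiberwise_lt j l hj (mul_neg_of_pos_of_neg ha (sub_neg.2 hat))
      (mul_pos hb (sub_pos.2 htb))
  have h3 : ∑ c, |l c| ≤ ∑ x, |Λ (ξ i).1 x| := by
    simp only [hplay]
    exact sum_sublinear_garbling_le (φ := fun t : ℝ => |t|) abs_zero abs_add_le
      (fun c v hc => by rw [smul_eq_mul, abs_mul, abs_of_nonneg hc]) (σ i) _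
  linarith

theorem BaseGame.IsEquilibrium.outcomeOf_mem_sBCE {G : BaseGame I Θ A}
    {T : Technology I Θ A} (hT : T.IsUnconstrainedRI) {ξ : ∀ i, T.feasible i}
    {σ : ∀ i, ActionPlan (T.X i) (A i)} (heq : G.IsEquilibrium T ξ σ) :
    G.outcomeOf T ξ σ ∈ G.sBCE := by
  classical
  have hq := (G.outcomeOf_mem_outcomes T ξ σ).1.1
  have hι : ∀ i, ∃ ι : A i → T.X i, Function.Injective ι := fun i => by
    obtain ⟨f⟩ := Function.Embedding.nonempty_of_card_le (T.card_action_lt i).le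
    exact ⟨f, f.injective⟩
  choose ι hι using hι
  have hob : ∀ (i : I) (c b : A i), G.expectedUtility i b (slice (G.outcomeOf T ξ σ) i c) ≤
      G.expectedUtility i c (slice (G.outcomeOf T ξ σ) i c) := by
    intro i c b
    -- Only the response to `c` is changed, so all other terms cancel.
    have h := (heq.sum_expectedUtility_relabel_le hT (hι i) id (Function.update id c b)).1
    rw [← Finset.add_sum_erase _ _ (Finset.mem_univ c),
      ← Finset.add_sum_erase _ _ (Finset.mem_univ c)] at h
    rw [Finset.sum_congr rfl fun d hd => by
      rw [id, Function.update_of_ne (Finset.ne_of_mem_erase hd), id]] at h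
    simp only [id, Function.update_self] at h
    linarith
  refine ⟨⟨G.outcomeOf_mem_outcomes T ξ σ, fun i c b =>
    (G.obedience_iff _ i c b).2 (hob i c b)⟩, fun i a b ha hb hab => ?_⟩
  rw [Set.eq_empty_iff_forall_notMem]
  rintro d ⟨hda, hdb⟩
  rw [G.mem_bestResponses_condBelief hq ha] at hda
  rw [G.mem_bestResponses_condBelief hq hb] at hdb
  -- Recommendation `b` is merged into `a`, and the common best response `d` is played there.
  have hd := (heq.sum_expectedUtility_relabel_le hT (hι i) (Function.update id b a)
    (Function.update id a d)).2 (Finset.sum_le_sum fun c _ => by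
      by_cases hcb : c = b
      · subst hcb
        simpa using hdb c
      · rw [Function.update_of_ne hcb, id]
        by_cases hca : c = a
        · subst hca
          simpa using hda c
        · rw [Function.update_of_ne hca, id])
  have hne : a ≠ b := fun h => hab (by rw [h])
  have hm : ι i (Function.update id b a a) = ι i (Function.update id b a b) := by
    rw [Function.update_self, Function.update_of_ne hne, id]
  obtain ⟨y, hy⟩ := Function.ne_iff.1 hab
  rcases hy.lt_or_gt with h | h
  · exact G.not_blackwellDominates_relabel T ξ σ ha hb h
      (j := fun c => ι i (Function.update id b a c)) hm hd
  · exact G.not_blackwellDominates_relabel T ξ σ hb ha h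
      (j := fun c => ι i (Function.update id b a c)) hm.symm hd

theorem BaseGame.IsVanishingCostEquilibrium.mem_closure_sBCE {G : BaseGame I Θ A}
    {p : (∀ i, A i) × Θ → ℝ} (hp : G.IsVanishingCostEquilibrium p) : p ∈ closure G.sBCE := by
  rw [Metric.mem_closure_iff]
  intro ε hε
  obtain ⟨T, hT, ξ, σ, heq, -, hd⟩ := hp.2 (ε / 2) (by positivity)
  refine ⟨_, heq.outcomeOf_mem_sBCE hT, ?_⟩
  refine lt_of_le_of_lt ((dist_pi_le_iff (by positivity)).2 fun y => ?_) (half_lt_self hε)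
  exact hd y.1 y.2

end Necessity

/-! ### Redrawing an action from its conditional law given the belief it induces. -/

section Redraw

variable {I Θ : Type*} {A : I → Type*} [Fintype I] [DecidableEq I] [Fintype Θ]
  [∀ i, Fintype (A i)]

/-- A function invariant under each coordinate kernel is invariant under their product. -/
theorem sum_mul_prod_kernel_eq {F : (∀ i, A i) → ℝ} {k : ∀ j, A j → A j → ℝ}
    (h : ∀ a j, ∑ c, F (Function.update a j c) * k j c (a j) = F a) (a : ∀ i, A i) :
    ∑ a', F a' * ∏ j, k j (a' j) (a j) = F a := by
  classical
  -- Induction on the set of coordinates already redrawn; the others carry the identity kernel.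
  have key : ∀ (J : Finset I) (a : ∀ i, A i), ∑ a', F a' *
      ∏ j, (if j ∈ J then k j (a' j) (a j) else if a' j = a j then 1 else 0) = F a := by
    intro J
    induction J using Finset.induction_on with
    | empty =>
      intro a
      simp only [Finset.notMem_empty, if_false]
      rw [Finset.sum_eq_single a]
      · simp
      · intro a' _ hne
        obtain ⟨j, hj⟩ := Function.ne_iff.1 hne
        rw [Finset.prod_eq_zero (Finset.mem_univ j) (if_neg hj), mul_zero]
      · simp
    | insert i J hi ih =>
      intro a
      rw [← h a i]
      simp only [← ih (Function.update a i _), Finset.sum_mul]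
      rw [Finset.sum_comm]
      refine Finset.sum_congr rfl fun a' _ => ?_
      simp only [← Finset.mul_prod_erase _ _ (Finset.mem_univ i), Finset.mem_insert_self, if_true,
        if_neg hi, Function.update_self]
      have hother : ∀ c, ∏ j ∈ Finset.univ.erase i, (if j ∈ J then
          k j (a' j) (Function.update a i c j) else
            if a' j = Function.update a i c j then 1 else 0) =
          ∏ j ∈ Finset.univ.erase i, (if j ∈ insert i J then k j (a' j) (a j) else
            if a' j = a j then 1 else 0) := by
        intro c
        refine Finset.prod_congr rfl fun j hj => ?_
        have hji := Finset.ne_of_mem_erase hj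
        simp only [Function.update_of_ne hji, Finset.mem_insert, hji, false_or]
      simp only [hother]
      rw [Finset.sum_eq_single (a' i)]
      · rw [if_pos rfl]
        ring
      · intro c _ hc
        rw [if_neg hc.symm]
        ring
      · simp
  simpa using key Finset.univ a

/-- Redrawing each coordinate of a mixture of products with invariant kernels does not change
the mixture. -/
theorem mixture_kernel_eq {Z : Type*} [Fintype Z] {F : (∀ i, A i) → ℝ}
    {τ : ∀ j, Z → A j → ℝ} {w : Z → ℝ} (hF : ∀ a, F a = ∑ z, (∏ j, τ j z (a j)) * w z)
    {k : ∀ j, A j → A j → ℝ} (h : ∀ a j, ∑ c, F (Function.update a j c) * k j c (a j) = F a)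
    (a : ∀ i, A i) : ∑ z, (∏ j, ∑ c, k j c (a j) * τ j z c) * w z = F a := by
  rw [← sum_mul_prod_kernel_eq h a]
  simp only [Fintype.prod_sum, hF, Finset.sum_mul, Finset.prod_mul_distrib]
  rw [Finset.sum_comm]
  exact Finset.sum_congr rfl fun a' _ => Finset.sum_congr rfl fun z _ => by ring

open Classical in
/-- The probability that player `i`'s action induces the belief `μ`. -/
noncomputable def beliefProb (q : (∀ i, A i) × Θ → ℝ) (i : I) (μ : Others A i × Θ → ℝ) : ℝ :=
  ∑ b, if condBelief q i b = μ then actionProb q i b else 0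

open Classical in
/-- The conditional law of player `i`'s action given that it induces the belief `μ`. -/
noncomputable def redraw [∀ i, Nonempty (A i)] {q : (∀ i, A i) × Θ → ℝ} (hq : ∀ y, 0 ≤ q y)
    (i : I) (μ : Others A i × Θ → ℝ) : stdSimplex ℝ (A i) :=
  -- A belief of probability zero gets an arbitrary law, which only ever carries zero weight.
  if h : beliefProb q i μ = 0 then stdSimplex.vertex (Classical.arbitrary _) else
    ⟨fun b => (if condBelief q i b = μ then actionProb q i b else 0) / beliefProb q i μ,
      fun b => div_nonneg (by split_ifs <;> [exact actionProb_nonneg hq i b; exact le_rfl])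
        (Finset.sum_nonneg fun b _ => by
          split_ifs <;> [exact actionProb_nonneg hq i b; exact le_rfl]),
      by rw [← Finset.sum_div]; exact div_self h⟩

theorem actionProb_le_beliefProb {q : (∀ i, A i) × Θ → ℝ} (hq : ∀ y, 0 ≤ q y) (i : I)
    (c : A i) : actionProb q i c ≤ beliefProb q i (condBelief q i c) := by
  classical
  refine le_trans (le_of_eq ?_) (Finset.single_le_sum (f := fun b =>
    if condBelief q i b = condBelief q i c then actionProb q i b else 0) (fun b _ => ?_)
    (Finset.mem_univ c))
  · rw [if_pos rfl]
  · split_ifs <;> [exact actionProb_nonneg hq i b; exact le_rfl]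

variable [∀ i, Nonempty (A i)]

open Classical in
theorem redraw_apply {q : (∀ i, A i) × Θ → ℝ} (hq : ∀ y, 0 ≤ q y) {i : I}
    {μ : Others A i × Θ → ℝ} (h : beliefProb q i μ ≠ 0) (b : A i) :
    (redraw hq i μ).1 b =
      (if condBelief q i b = μ then actionProb q i b else 0) / beliefProb q i μ := by
  rw [redraw, dif_neg h]

/-- Within one belief class the slices are proportional to the action probabilities, and these are
the weights used in redrawing. -/
theorem sum_slice_mul_redraw {q : (∀ i, A i) × Θ → ℝ} (hq : ∀ y, 0 ≤ q y) (i : I) (b : A i)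
    (y : Others A i × Θ) :
    ∑ c, slice q i c y * (redraw hq i (condBelief q i c)).1 b = slice q i b y := by
  classical
  have h : ∀ c, slice q i c y * (redraw hq i (condBelief q i c)).1 b =
      (if condBelief q i c = condBelief q i b then actionProb q i c else 0) *
        (slice q i b y / beliefProb q i (condBelief q i b)) := by
    intro c
    rcases (actionProb_nonneg hq i c).eq_or_lt with h0 | h0
    · rw [actionProb_mul_condBelief hq i c, ← h0]
      simp
    · have h1 := (h0.trans_le (actionProb_le_beliefProb hq i c)).ne'
      rw [redraw_apply hq h1]
      by_cases hcb : condBelief q i c = condBelief q i b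
      · rw [if_pos hcb, if_pos hcb.symm, actionProb_mul_condBelief hq i c,
          actionProb_mul_condBelief hq i b, hcb]
        ring
      · rw [if_neg hcb, if_neg (Ne.symm hcb)]
        ring
  simp only [h]
  rw [← Finset.sum_mul]
  change beliefProb q i (condBelief q i b) * _ = _
  by_cases h0 : beliefProb q i (condBelief q i b) = 0
  · have h1 := le_antisymm (h0 ▸ actionProb_le_beliefProb hq i b) (actionProb_nonneg hq i b)
    rw [actionProb_mul_condBelief hq i b, h0, h1]
    ring
  · exact mul_div_cancel₀ _ h0

theorem sum_update_mul_redraw {q : (∀ i, A i) × Θ → ℝ} (hq : ∀ y, 0 ≤ q y) (a : ∀ i, A i)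
    (j : I) (θ : Θ) :
    ∑ c, q (Function.update a j c, θ) * (redraw hq j (condBelief q j c)).1 (a j) = q (a, θ) := by
  have h := sum_slice_mul_redraw hq j (a j) (fun j => a j, θ)
  simpa only [slice, profile_eq_update, Function.update_eq_self] using h

/-- The law of actions after redrawing within belief classes. -/
noncomputable def redrawnLaw {Z : Type*} {q : (∀ i, A i) × Θ → ℝ} (hq : ∀ y, 0 ≤ q y)
    (τ : ∀ j, Z → Θ → stdSimplex ℝ (A j)) (j : I) (z : Z) (θ : Θ) : stdSimplex ℝ (A j) :=
  kernelComp (fun c => redraw hq j (condBelief q j c)) (τ j z θ)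

variable {Z : Type*} [Fintype Z] {q : (∀ i, A i) × Θ → ℝ} (hq : ∀ y, 0 ≤ q y)
  {τ : ∀ j, Z → Θ → stdSimplex ℝ (A j)} {w : Z → Θ → ℝ}

theorem mixture_redrawnLaw
    (hrep : ∀ a θ, q (a, θ) = ∑ z, (∏ j, (τ j z θ).1 (a j)) * w z θ) (a : ∀ i, A i) (θ : Θ) :
    ∑ z, (∏ j, (redrawnLaw hq τ j z θ).1 (a j)) * w z θ = q (a, θ) :=
  mixture_kernel_eq (F := fun a => q (a, θ)) (τ := fun j z => (τ j z θ).1)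
    (w := fun z => w z θ) (fun a => hrep a θ)
    (k := fun j c b => (redraw hq j (condBelief q j c)).1 b)
    (fun a j => sum_update_mul_redraw hq a j θ) a

/-- Player `i`'s coordinate gets the identity kernel while the others redraw. Thus the drawn action
`c` leads to the belief of `q` even though the opponents redraw their actions. -/
theorem slice_eq_mixture_redrawnLaw
    (hrep : ∀ a θ, q (a, θ) = ∑ z, (∏ j, (τ j z θ).1 (a j)) * w z θ) (i : I) (c : A i)
    (y : Others A i × Θ) :
    slice q i c y = ∑ z, (τ i z y.2).1 c * w z y.2 *
      ∏ j : {j : I // j ≠ i}, (redrawnLaw hq τ j z y.2).1 (y.1 j) := by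
  classical
  set k : ∀ j, A j → A j → ℝ := fun j c b =>
    if j = i then (if c = b then 1 else 0) else (redraw hq j (condBelief q j c)).1 b with hk
  have h := mixture_kernel_eq (F := fun a => q (a, y.2)) (τ := fun j z => (τ j z y.2).1)
    (w := fun z => w z y.2) (fun a => hrep a y.2) (k := k) (fun a j => by
      by_cases hj : j = i
      · simp [hk, hj]
      · simp only [hk, if_neg hj]
        exact sum_update_mul_redraw hq a j y.2) (profile i c y.1)
  refine h.symm.trans (Finset.sum_congr rfl fun z _ => ?_)
  rw [prod_profile i (fun j b => ∑ c, k j c b * (τ j z y.2).1 c)]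
  have h1 : ∑ d, k i d c * (τ i z y.2).1 d = (τ i z y.2).1 c := by simp [hk]
  have h2 : ∀ j : {j : I // j ≠ i}, ∑ d, k j d (y.1 j) * (τ j z y.2).1 d =
      (redrawnLaw hq τ j z y.2).1 (y.1 j) := fun j => by
    simp only [hk, if_neg j.2]
    rfl
  rw [h1, Finset.prod_congr rfl fun j _ => h2 j]
  ring

end Redraw

/-! ### From a separated equilibrium with a mixture representation to a technology. -/

section Implementation

variable {I Θ : Type*} {A : I → Type*} [Fintype I] [DecidableEq I] [Fintype Θ]
  [∀ i, Fintype (A i)]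

theorem planPayoff_eq_playLaw {Z Θ X B : Type*} [Fintype Z] [Fintype Θ] [Fintype X] [Fintype B]
    (w : Z → Θ → ℝ) (U : B → Z → Θ → ℝ) (e : Experiment Z Θ X) (r : ActionPlan X B) :
    planPayoff (fun s : Z × Θ => w s.1 s.2) (fun b s => U b s.1 s.2) (fun s => e s.1 s.2) r =
      ∑ z, ∑ θ, ∑ b, playLaw e r z θ b * (U b z θ * w z θ) := by
  unfold planPayoff playLaw
  simp only [Fintype.sum_prod_type, Finset.mul_sum, Finset.sum_mul]
  have h : ∀ x : X, ∑ b, ∑ z, ∑ θ, (r x).1 b * (U b z θ * (w z θ * (e z θ).1 x)) =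
      ∑ z, ∑ θ, ∑ b, (r x).1 b * (U b z θ * (w z θ * (e z θ).1 x)) := fun x => by
    rw [Finset.sum_comm]
    exact Finset.sum_congr rfl fun z _ => Finset.sum_comm
  simp only [h]
  rw [Finset.sum_comm]
  refine Finset.sum_congr rfl fun z _ => ?_
  rw [Finset.sum_comm]
  refine Finset.sum_congr rfl fun θ _ => ?_
  rw [Finset.sum_comm]
  exact Finset.sum_congr rfl fun b _ => Finset.sum_congr rfl fun x _ => by ring

/-- A labelling of beliefs by elements of a large enough set. -/
theorem exists_belief_labelling {B M X : Type*} [Fintype B] [Nonempty B] [Fintype X]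
    (hX : Fintype.card B ≤ Fintype.card X) (p : B → M) :
    ∃ (f : B → X) (bel : X → M), (∀ b, bel (f b) = p b) ∧ ∀ a b, p a = p b → f a = f b := by
  obtain ⟨ι⟩ := Function.Embedding.nonempty_of_card_le hX
  -- Each belief is labelled by the code of one chosen action that induces it.
  refine ⟨fun b => ι (Function.invFun p (p b)), fun x => p (Function.invFun ι x), fun b => ?_,
    fun a b h => by simp only [h]⟩
  dsimp only
  rw [Function.leftInverse_invFun ι.injective]
  exact Function.invFun_eq ⟨b, rfl⟩

variable [∀ i, Nonempty (A i)]

/-- A separated Bayes correlated equilibrium with a representation as a mixture of products, under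
which full information is not very valuable, is the outcome of an equilibrium with small costs. -/
theorem BaseGame.exists_technology (G : BaseGame I Θ A) {q : (∀ i, A i) × Θ → ℝ}
    (hqs : q ∈ G.sBCE) (hq : ∀ y, 0 ≤ q y) {Z : Type} [Fintype Z] (ζ : Θ → stdSimplex ℝ Z)
    (τ : ∀ j, Z → Θ → stdSimplex ℝ (A j))
    (hrep : ∀ a θ, q (a, θ) = ∑ z, (∏ j, (τ j z θ).1 (a j)) * ((ζ θ).1 z * G.prior.1 θ))
    {ε : ℝ} (hε : 0 < ε)
    (hsmall : ∀ i (r : Z → Θ → A i), ∑ z, ∑ θ,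
      G.statePayoff i (fun j z θ => (redrawnLaw hq τ j z θ).1) (r z θ) z θ *
        ((ζ θ).1 z * G.prior.1 θ) ≤ ∑ a, ∑ θ, G.u i a θ * q (a, θ) + ε / 2) :
    ∃ T : Technology I Θ A, T.IsUnconstrainedRI ∧
      ∃ (ξ : ∀ i, T.feasible i) (σ : ∀ i, ActionPlan (T.X i) (A i)),
        G.IsEquilibrium T ξ σ ∧ (∀ (i : I) (e : T.feasible i), (T.cost i e : ℝ) ≤ ε) ∧
        G.outcomeOf T ξ σ = q := by
  classical
  set X : I → Type := fun i => Fin (Fintype.card (A i) + Fintype.card (Z × Θ) + 1) with hX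
  have hlab := fun i => exists_belief_labelling (X := X i) (by simp [hX]; omega)
    (condBelief q i)
  choose f bel hbel hf using hlab
  set w : Z → Θ → ℝ := fun z θ => (ζ θ).1 z * G.prior.1 θ with hwdef
  have hw : ∀ z θ, 0 ≤ w z θ := fun z θ => mul_nonneg ((ζ θ).2.1 z) (G.prior_pos θ).le
  set ξ : ∀ i, Experiment Z Θ (X i) := fun i z θ =>
    kernelComp (fun c => stdSimplex.vertex (f i c)) (τ i z θ) with hξ
  set σ : ∀ i, ActionPlan (X i) (A i) := fun i x => redraw hq i (bel i x) with hσ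
  set K : ∀ j, Z → Θ → A j → ℝ := fun j z θ => (redrawnLaw hq τ j z θ).1 with hK
  have hplay : ∀ i, playLaw (ξ i) (σ i) = K i := by
    intro i
    funext z θ b
    have h := sum_kernelComp_mul (fun c => stdSimplex.vertex (f i c)) (τ i z θ)
      fun x => (σ i x).1 b
    simp only [sum_vertex_mul] at h
    simp only [playLaw, hK, redrawnLaw, kernelComp_apply _ (τ i z θ), hξ, mul_comm] at h ⊢
    rw [h]
    exact Finset.sum_congr rfl fun c _ => by simp only [hσ, hbel]
  have hmix : ∀ a θ, ∑ z, (∏ j, K j z θ (a j)) * w z θ = q (a, θ) := mixture_redrawnLaw hq hrep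
  have hslice := fun i c y => slice_eq_mixture_redrawnLaw hq hrep i c y
  have hact : ∀ i c, actionProb q i c = ∑ z, ∑ θ, (τ i z θ).1 c * w z θ := fun i c =>
    actionProb_of_mixture K (fun j z θ => (redrawnLaw hq τ j z θ).2.2) _
      _ fun m θ => hslice i c (m, θ)
  have hutil : ∀ i b c, G.expectedUtility i b (slice q i c) = ∑ z, ∑ θ, (τ i z θ).1 c *
      (G.statePayoff i K b z θ * w z θ) := fun i b c =>
    G.expectedUtility_profile i K w (fun z θ => (τ i z θ).1 c) _ (hslice i c) b
  set W : Z × Θ → ℝ := fun s => w s.1 s.2 with hW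
  set U : ∀ i, A i → Z × Θ → ℝ := fun i b s => G.statePayoff i K b s.1 s.2 with hU
  set E : ∀ i, Z × Θ → stdSimplex ℝ (X i) := fun i s => ξ i s.1 s.2 with hE
  set μ : ∀ i, X i → ℝ := fun i x => ∑ c, (stdSimplex.vertex (S := ℝ) (f i c)).1 x *
    actionProb q i c with hμ
  -- All actions with label `x` induce the same belief, so the signal's payoff is its probability `μ
  -- i x` times the expected utility under that belief.
  have hsig : ∀ i x b, signalPayoff W (U i) (E i) x b =
      μ i x * G.expectedUtility i b (bel i x) := by
    intro i x b
    have h1 : signalPayoff W (U i) (E i) x b = ∑ c, (stdSimplex.vertex (S := ℝ) (f i c)).1 x *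
        G.expectedUtility i b (slice q i c) := by
      simp only [hutil]
      rw [← sum_sum_sum_mul, ← Fintype.sum_prod_type']
      exact Finset.sum_congr rfl fun s _ => by
        simp only [hU, hW, hE, hξ, kernelComp_apply]
        ring
    rw [h1, Finset.sum_mul]
    refine Finset.sum_congr rfl fun c _ => ?_
    rw [vertex_apply]
    split_ifs with hc
    · rw [G.expectedUtility_slice hq, ← hc, hbel, mul_assoc]
    · ring
  have hpost : ∀ i x, posterior W (E i) x ≠ 0 → 0 < μ i x := by
    intro i x hne
    have h1 : μ i x = ∑ s, W s * (E i s).1 x := by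
      simp only [hμ, hact]
      have h2 := sum_sum_sum_mul (fun c => (stdSimplex.vertex (S := ℝ) (f i c)).1 x)
        (fun c z θ => (τ i z θ).1 c) w
      rw [← h2, ← Fintype.sum_prod_type']
      exact Finset.sum_congr rfl fun s _ => by
        simp only [hW, hE, hξ, kernelComp_apply]
        ring
    rw [h1]
    exact lt_of_lt_of_le (norm_pos_iff.2 hne) (norm_posterior_le (fun s => hw _ _) _ _)
  have hμex : ∀ i x, μ i x ≠ 0 → ∃ c, f i c = x ∧ 0 < actionProb q i c := by
    intro i x h
    obtain ⟨c, -, hc⟩ := Finset.exists_ne_zero_of_sum_ne_zero h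
    rw [vertex_apply] at hc
    split_ifs at hc with hfc
    · rw [one_mul] at hc
      exact ⟨c, hfc, lt_of_le_of_ne (actionProb_nonneg hq i c) hc.symm⟩
    · simp at hc
  have hμ0 : ∀ i x, 0 ≤ μ i x := fun i x => Finset.sum_nonneg fun c _ =>
    mul_nonneg ((stdSimplex.vertex (S := ℝ) (f i c)).2.1 x) (actionProb_nonneg hq i c)
  have hopt : ∀ i x b, (σ i x).1 b ≠ 0 →
      ∀ c, signalPayoff W (U i) (E i) x c ≤ signalPayoff W (U i) (E i) x b := by
    intro i x b hb d
    rw [hsig, hsig]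
    by_cases h0 : μ i x = 0
    · simp [h0]
    obtain ⟨c, rfl, hc⟩ := hμex i x h0
    refine mul_le_mul_of_nonneg_left ?_ (hμ0 _ _)
    simp only [hσ, hbel] at hb ⊢
    rw [redraw_apply hq (hc.trans_le (actionProb_le_beliefProb hq i c)).ne'] at hb
    have hbc : condBelief q i b = condBelief q i c := by
      by_contra h
      simp [h] at hb
    have hb0 : 0 < actionProb q i b := by
      refine lt_of_le_of_ne (actionProb_nonneg hq i b) fun h => ?_
      simp [← h] at hb
    have hob := (G.obedience_iff q i b d).1 (hqs.1.2 i b d)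
    rw [G.expectedUtility_slice hq, G.expectedUtility_slice hq] at hob
    rw [← hbc]
    exact le_of_mul_le_mul_left hob hb0
  have hsep : ∀ i x x' b, posterior W (E i) x ≠ 0 → posterior W (E i) x' ≠ 0 →
      (∀ c, signalPayoff W (U i) (E i) x c ≤ signalPayoff W (U i) (E i) x b) →
      (∀ c, signalPayoff W (U i) (E i) x' c ≤ signalPayoff W (U i) (E i) x' b) → x = x' := by
    intro i x x' b hx hx' hb hb'
    have h1 := hpost i x hx
    have h2 := hpost i x' hx'
    obtain ⟨c, rfl, hc⟩ := hμex i x h1.ne'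
    obtain ⟨c', rfl, hc'⟩ := hμex i x' h2.ne'
    apply hf
    by_contra hne
    have hempty := hqs.2 i c c' hc hc' hne
    refine Set.notMem_empty b (hempty ▸ ⟨fun d => ?_, fun d => ?_⟩)
    · have := hb d
      rw [hsig, hsig, hbel] at this
      exact le_of_mul_le_mul_left this h1
    · have := hb' d
      rw [hsig, hsig, hbel] at this
      exact le_of_mul_le_mul_left this h2
  have hvalue : ∀ i, planPayoff W (U i) (E i) (σ i) = ∑ a, ∑ θ, G.u i a θ * q (a, θ) := by
    intro i
    refine (planPayoff_eq_playLaw w (G.statePayoff i K) (ξ i) (σ i)).trans ?_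
    simp only [hplay, ← mul_assoc, ← Finset.sum_mul, G.sum_mul_statePayoff, ← hmix]
    rw [Finset.sum_comm]
    rw [Finset.sum_comm (s := (Finset.univ : Finset (∀ i, A i)))]
    refine Finset.sum_congr rfl fun θ _ => ?_
    simp only [Finset.sum_mul, Finset.mul_sum]
    rw [Finset.sum_comm]
    exact Finset.sum_congr rfl fun a _ => Finset.sum_congr rfl fun z _ => by ring
  have hcost := fun i => exists_small_monotone_cost (w := W) (fun s => hw s.1 s.2) (hopt i)
    (hsep i) hε (fun r => by
      rw [hvalue, Fintype.sum_prod_type]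
      exact hsmall i fun z θ => r (z, θ))
  choose C hCmono hC0 hCε hC using hcost
  let T : Technology I Θ A :=
    { Z := Z
      ζ := ζ
      X := X
      card_action_lt := fun i => by simp only [hX, Fintype.card_fin]; omega
      card_state_lt := fun i => by simp only [hX, Fintype.card_fin]; omega
      feasible := fun _ => Set.univ
      cost := fun i e => C i fun s => e.1 s.1 s.2
      exists_cost_eq_zero := fun i => by
        obtain ⟨e, he⟩ := hC0 i
        exact ⟨⟨fun z θ => e (z, θ), trivial⟩, he⟩ }
  have hgarb : ∀ i (e e' : Experiment Z Θ (X i)), T.BlackwellDominates (i := i) e e' ↔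
      IsGarbling W (fun s => e s.1 s.2) (fun s => e' s.1 s.2) := by
    intro i e e'
    -- The full support of the prior makes the two notions of relevant state coincide.
    have hpos : ∀ z θ, 0 < W (z, θ) ↔ 0 < (ζ θ).1 z := fun z θ =>
      mul_pos_iff_of_pos_right (G.prior_pos θ)
    constructor
    · rintro ⟨g, hg⟩
      exact ⟨g, fun x s hs => hg x s.2 s.1 ((hpos _ _).1 hs)⟩
    · rintro ⟨g, hg⟩
      exact ⟨g, fun x θ z hz => hg x (z, θ) ((hpos _ _).2 hz)⟩
  refine ⟨T, fun i => ⟨rfl, fun e e' h => ?_⟩, fun i => ⟨ξ i, trivial⟩, σ, fun i e r => ?_,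
    fun i e => hCε i _, ?_⟩
  · have h1 := hCmono i _ _ ((hgarb i _ _).1 h)
    exact ⟨h1.1, fun hn => h1.2 fun h' => hn ((hgarb i _ _).2 h')⟩
  · have hpay : ∀ (e : Experiment Z Θ (X i)) (r : ActionPlan (X i) (A i)),
        G.grossPayoff T i e r ξ σ = planPayoff W (U i) (fun s => e s.1 s.2) r := by
      intro e r
      rw [G.grossPayoff_eq]
      refine Eq.trans ?_ (planPayoff_eq_playLaw w (G.statePayoff i K) e r).symm
      have hKp : (fun j => playLaw (ξ j) (σ j)) = K := funext hplay
      rw [← hKp]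
    have h1 := hC i (fun s => e.1 s.1 s.2) r
    rw [← hpay e.1 r] at h1
    have h2 := hpay (ξ i) (σ i)
    rw [← h2] at h1
    exact h1
  · funext ⟨a, θ⟩
    rw [G.outcomeOf_eq, ← hmix]
    refine Finset.sum_congr rfl fun z _ => ?_
    simp only [← hplay]
    rfl

/-- `BaseGame.exists_technology` with a mixture indexed by a finite type in any universe. -/
theorem BaseGame.exists_technology_of_fintype (G : BaseGame I Θ A) {q : (∀ i, A i) × Θ → ℝ}
    (hqs : q ∈ G.sBCE) (hq : ∀ y, 0 ≤ q y) {Z : Type*} [Fintype Z] (ζ : Θ → stdSimplex ℝ Z)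
    (τ : ∀ j, Z → Θ → stdSimplex ℝ (A j))
    (hrep : ∀ a θ, q (a, θ) = ∑ z, (∏ j, (τ j z θ).1 (a j)) * ((ζ θ).1 z * G.prior.1 θ))
    {ε : ℝ} (hε : 0 < ε)
    (hsmall : ∀ i (r : Z → Θ → A i), ∑ z, ∑ θ,
      G.statePayoff i (fun j z θ => (redrawnLaw hq τ j z θ).1) (r z θ) z θ *
        ((ζ θ).1 z * G.prior.1 θ) ≤ ∑ a, ∑ θ, G.u i a θ * q (a, θ) + ε / 2) :
    ∃ T : Technology I Θ A, T.IsUnconstrainedRI ∧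
      ∃ (ξ : ∀ i, T.feasible i) (σ : ∀ i, ActionPlan (T.X i) (A i)),
        G.IsEquilibrium T ξ σ ∧ (∀ (i : I) (e : T.feasible i), (T.cost i e : ℝ) ≤ ε) ∧
        G.outcomeOf T ξ σ = q := by
  set φ := (Fintype.equivFin Z).symm with hφ
  refine G.exists_technology hqs hq
    (fun θ => ⟨fun z => (ζ θ).1 (φ z), fun z => (ζ θ).2.1 _, by
      rw [φ.sum_comp (fun z => (ζ θ).1 z)]; exact (ζ θ).2.2⟩)
    (fun j z θ => τ j (φ z) θ) (fun a θ => ?_) hε fun i r => ?_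
  · rw [hrep, ← φ.sum_comp]
  · refine le_trans (le_of_eq ?_) (hsmall i fun z θ => r (φ.symm z) θ)
    rw [← φ.sum_comp]
    simp only [Equiv.symm_apply_apply]
    rfl

end Implementation

/-! ### Nash outcomes in the closure are vanishing-cost equilibria. -/

section Sufficiency

variable {I Θ : Type*} {A : I → Type*} [Fintype I] [DecidableEq I] [Fintype Θ]
  [∀ i, Fintype (A i)]

/-- A function that is close to an invariant one is moved little by a product of kernels. -/
theorem sum_abs_kernel_sub_le {F : (∀ i, A i) → ℝ} {k : ∀ j, A j → stdSimplex ℝ (A j)}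
    (h : ∀ a j, ∑ c, F (Function.update a j c) * (k j c).1 (a j) = F a) (H : (∀ i, A i) → ℝ) :
    ∑ a, |∑ a', H a' * ∏ j, (k j (a' j)).1 (a j) - H a| ≤ 2 * ∑ a, |H a - F a| := by
  have hF := sum_mul_prod_kernel_eq (k := fun j c b => (k j c).1 b) h
  have hnn : ∀ a' a : (∀ i, A i), 0 ≤ ∏ j, (k j (a' j)).1 (a j) := fun a' a =>
    Finset.prod_nonneg fun j _ => (k j (a' j)).2.1 (a j)
  have h1 : ∀ a, |∑ a', H a' * ∏ j, (k j (a' j)).1 (a j) - H a| ≤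
      ∑ a', |H a' - F a'| * ∏ j, (k j (a' j)).1 (a j) + |H a - F a| := by
    intro a
    -- Since `F` is invariant, only `H - F` is moved, and a Markov kernel does not increase its
    -- total absolute mass.
    have h2 : ∑ a', H a' * ∏ j, (k j (a' j)).1 (a j) - H a =
        ∑ a', (H a' - F a') * ∏ j, (k j (a' j)).1 (a j) - (H a - F a) := by
      simp only [sub_mul, Finset.sum_sub_distrib, hF]
      ring
    rw [h2]
    refine (abs_sub _ _).trans (add_le_add_left ((Finset.abs_sum_le_sum_abs _ _).trans
      (le_of_eq (Finset.sum_congr rfl fun a' _ => ?_))) _)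
    rw [abs_mul, abs_of_nonneg (hnn a' a)]
  refine (Finset.sum_le_sum fun a _ => h1 a).trans (le_of_eq ?_)
  rw [Finset.sum_add_distrib, Finset.sum_comm, two_mul]
  congr 1
  refine Finset.sum_congr rfl fun a' _ => ?_
  rw [← Finset.mul_sum, ← Fintype.prod_sum]
  simp only [(k _ _).2.2, Finset.prod_const_one, mul_one]

theorem abs_sum_mul_le {C : Type*} [Fintype C] {u v : C → ℝ} {M : ℝ} (hu : ∀ c, |u c| ≤ M) :
    |∑ c, u c * v c| ≤ M * ∑ c, |v c| := by
  rw [Finset.mul_sum]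
  refine (Finset.abs_sum_le_sum_abs _ _).trans (Finset.sum_le_sum fun c _ => ?_)
  rw [abs_mul]
  exact mul_le_mul_of_nonneg_right (hu c) (abs_nonneg _)

section StatePayoff

variable {Z : Type*} (G : BaseGame I Θ A) {i : I} {M : ℝ}
  (K K' : ∀ j, Z → Θ → stdSimplex ℝ (A j)) (z : Z) (θ : Θ)

theorem BaseGame.abs_statePayoff_le (hM : ∀ a θ, |G.u i a θ| ≤ M) (b : A i) :
    |G.statePayoff i (fun j z θ => (K j z θ).1) b z θ| ≤ M := by
  refine (abs_sum_mul_le fun m => hM _ θ).trans (le_of_eq ?_)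
  have h : ∀ m : Others A i, |∏ j : {j : I // j ≠ i}, (K j z θ).1 (m j)| =
      ∏ j : {j : I // j ≠ i}, (K j z θ).1 (m j) := fun m =>
    abs_of_nonneg (Finset.prod_nonneg fun j _ => (K j z θ).2.1 (m j))
  simp only [h]
  rw [← Fintype.prod_sum fun (j : {j : I // j ≠ i}) c => (K j z θ).1 c]
  simp only [(K _ z θ).2.2, Finset.prod_const_one, mul_one]

theorem BaseGame.abs_sum_mul_prod_le (hM : ∀ a θ, |G.u i a θ| ≤ M) :
    |∑ a, G.u i a θ * ∏ j, (K j z θ).1 (a j)| ≤ M := by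
  refine (abs_sum_mul_le fun a => hM a θ).trans (le_of_eq ?_)
  have h : ∀ a : ∀ j, A j, |∏ j, (K j z θ).1 (a j)| = ∏ j, (K j z θ).1 (a j) := fun a =>
    abs_of_nonneg (Finset.prod_nonneg fun j _ => (K j z θ).2.1 (a j))
  simp only [h]
  rw [← Fintype.prod_sum fun j c => (K j z θ).1 c]
  simp only [(K _ z θ).2.2, Finset.prod_const_one, mul_one]

theorem BaseGame.abs_statePayoff_sub_le (hM : ∀ a θ, |G.u i a θ| ≤ M) (b : A i) :
    |G.statePayoff i (fun j z θ => (K j z θ).1) b z θ -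
        G.statePayoff i (fun j z θ => (K' j z θ).1) b z θ| ≤
      M * ∑ a : (∀ j, A j), |∏ j, (K j z θ).1 (a j) - ∏ j, (K' j z θ).1 (a j)| := by
  have hM0 : 0 ≤ M := by
    by_cases h : Nonempty (∀ j, A j)
    · exact (abs_nonneg _).trans (hM (Classical.choice h) θ)
    · rw [not_nonempty_iff, isEmpty_pi] at h
      obtain ⟨j, hj⟩ := h
      have := (K j z θ).2.2
      simp at this
  unfold BaseGame.statePayoff
  rw [← Finset.sum_sub_distrib]
  simp only [← mul_sub]
  refine (abs_sum_mul_le fun m => hM _ θ).trans (mul_le_mul_of_nonneg_left ?_ hM0)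
  rw [sum_profile i, Finset.sum_comm]
  refine Finset.sum_le_sum fun m _ => ?_
  -- The opponents' law is a marginal of the full product, and taking marginals does not increase
  -- the `L¹` distance.
  have hmarg : ∀ L : ∀ j, Z → Θ → stdSimplex ℝ (A j),
      ∏ j : {j : I // j ≠ i}, (L j z θ).1 (m j) =
        ∑ c, ∏ j, (L j z θ).1 (profile i c m j) := by
    intro L
    simp only [prod_profile i (fun j => (L j z θ).1)]
    rw [← Finset.sum_mul, (L i z θ).2.2, one_mul]
  rw [hmarg K, hmarg K', ← Finset.sum_sub_distrib]
  exact Finset.abs_sum_le_sum_abs _ _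

/-- Near a Nash equilibrium of the complete-information game, deviations gain little. -/
theorem BaseGame.statePayoff_le_of_near_nash (hM : ∀ a θ, |G.u i a θ| ≤ M)
    (hnash : ∀ β : stdSimplex ℝ (A i),
      ∑ a : (∀ j, A j), G.u i a θ * β.1 (a i) * ∏ j ∈ Finset.univ.erase i, (K' j z θ).1 (a j) ≤
        ∑ a : (∀ j, A j), G.u i a θ * (K' i z θ).1 (a i) *
          ∏ j ∈ Finset.univ.erase i, (K' j z θ).1 (a j)) (b : A i) :
    G.statePayoff i (fun j z θ => (K j z θ).1) b z θ ≤
      ∑ a, G.u i a θ * ∏ j, (K j z θ).1 (a j) +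
        2 * M * ∑ a : (∀ j, A j), |∏ j, (K j z θ).1 (a j) - ∏ j, (K' j z θ).1 (a j)| := by
  classical
  have h1 := le_of_abs_le (G.abs_statePayoff_sub_le K K' z θ hM b)
  have h2 := hnash (stdSimplex.vertex b)
  have h3 : ∀ β : stdSimplex ℝ (A i), ∑ a : (∀ j, A j), G.u i a θ * β.1 (a i) *
      ∏ j ∈ Finset.univ.erase i, (K' j z θ).1 (a j) =
      ∑ c, β.1 c * G.statePayoff i (fun j z θ => (K' j z θ).1) c z θ := by
    intro β
    rw [sum_profile i]
    refine Finset.sum_congr rfl fun c _ => ?_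
    unfold BaseGame.statePayoff
    rw [Finset.mul_sum]
    refine Finset.sum_congr rfl fun m _ => ?_
    rw [prod_erase_profile i (fun j => (K' j z θ).1), profile_same]
    ring
  rw [h3, h3, sum_vertex_mul, G.sum_mul_statePayoff i (fun j z θ => (K' j z θ).1)] at h2
  have h4 := abs_sum_mul_le (u := fun a => G.u i a θ) (fun a => hM a θ)
    (v := fun a => ∏ j, (K j z θ).1 (a j) - ∏ j, (K' j z θ).1 (a j))
  simp only [mul_sub, Finset.sum_sub_distrib] at h4
  have h5 := neg_le_of_abs_le h4
  linarith

end StatePayoff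

/-- A complete-information equilibrium in the closure of the separated Bayes correlated equilibria
is a vanishing cost equilibrium. -/
theorem BaseGame.IsCompleteInfoNash.isVanishingCostEquilibrium {G : BaseGame I Θ A}
    {p : (∀ i, A i) × Θ → ℝ} (hp : G.IsCompleteInfoNash p) (hcl : p ∈ closure G.sBCE) :
    G.IsVanishingCostEquilibrium p := by
  classical
  refine ⟨hp.1, fun ε hε => ?_⟩
  have hA : ∀ i, Nonempty (A i) := by
    have h1 : ∃ y, p y ≠ 0 := by
      by_contra! h
      have := hp.1.1.2
      simp [h] at this
    obtain ⟨⟨a, θ⟩, -⟩ := h1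
    exact fun i => ⟨a i⟩
  obtain ⟨M, hM0, hM⟩ : ∃ M : ℝ, 0 ≤ M ∧ ∀ i a θ, |G.u i a θ| ≤ M := by
    refine ⟨∑ i, ∑ a, ∑ θ, |G.u i a θ|, by positivity, fun i a θ => ?_⟩
    refine le_trans ?_ (Finset.single_le_sum (f := fun i => ∑ a, ∑ θ, |G.u i a θ|)
      (fun i _ => by positivity) (Finset.mem_univ i))
    refine le_trans ?_ (Finset.single_le_sum (f := fun a => ∑ θ, |G.u i a θ|)
      (fun i _ => by positivity) (Finset.mem_univ a))
    exact Finset.single_le_sum (f := fun θ => |G.u i a θ|)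
      (fun i _ => by positivity) (Finset.mem_univ θ)
  -- The gain from full information will be at most `4 * M * δ * (1 - δ) + 2 * M * δ`, hence at most
  -- `6 * M * δ`.
  obtain ⟨δ, hδ0, hδ1, hδ⟩ : ∃ δ : ℝ, 0 < δ ∧ δ < 1 ∧ 6 * M * δ ≤ ε / 2 := by
    refine ⟨min (1 / 2) (ε / (12 * (M + 1))), lt_min (by norm_num) (by positivity),
      (min_le_left _ _).trans_lt (by norm_num), ?_⟩
    have h : min (1 / 2) (ε / (12 * (M + 1))) ≤ ε / (12 * (M + 1)) := min_le_right _ _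
    have h0 : 0 < min (1 / 2) (ε / (12 * (M + 1))) := lt_min (by norm_num) (by positivity)
    rw [le_div_iff₀ (by positivity)] at h
    nlinarith
  have hp0 := hp.1.1.1
  -- The lower bound is an open condition only where `p y > 0`; elsewhere it follows from `0 ≤ q y`.
  have hnear : ∀ᶠ q in nhds p, (∀ y, 0 < p y → (1 - δ) * p y ≤ q y) ∧
      (∀ θ, ∑ a, |p (a, θ) - q (a, θ)| ≤ δ * G.prior.1 θ) ∧ ∀ y, |p y - q y| ≤ ε := by
    simp only [Filter.eventually_and, Filter.eventually_all]
    refine ⟨fun y hy => ?_, fun θ => ?_, fun y => ?_⟩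
    · have hc : Continuous fun q : (∀ i, A i) × Θ → ℝ => q y := continuous_apply y
      exact ((hc.tendsto p).eventually_const_lt (by nlinarith)).mono fun _ h => h.le
    · have hc : Continuous fun q : (∀ i, A i) × Θ → ℝ => ∑ a, |p (a, θ) - q (a, θ)| := by
        fun_prop
      refine ((hc.tendsto p).eventually_lt_const ?_).mono fun _ h => h.le
      simpa using mul_pos hδ0 (G.prior_pos θ)
    · have hc : Continuous fun q : (∀ i, A i) × Θ → ℝ => |p y - q y| := by fun_prop
      exact ((hc.tendsto p).eventually_lt_const (by simpa using hε)).mono fun _ h => h.le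
  obtain ⟨q, hqs, hqp, hqd, hqε⟩ :=
    ((mem_closure_iff_frequently.1 hcl).and_eventually hnear).exists
  have hq := hqs.1.1.1.1
  have hqp' : ∀ y, (1 - δ) * p y ≤ q y := fun y => by
    rcases (hp0 y).eq_or_lt with h | h
    · rw [← h, mul_zero]
      exact hq y
    · exact hqp y h
  choose α hα hnash using hp.2
  have hα' : ∀ a θ, p (a, θ) = (∏ j, (α θ j).1 (a j)) * G.prior.1 θ := fun a θ =>
    (div_eq_iff (G.prior_pos θ).ne').1 (hα θ a)
  have hsome : ∀ θ, ∑ a, (q (a, θ) - (1 - δ) * p (a, θ)) / G.prior.1 θ = δ := fun θ => by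
    rw [← Finset.sum_div, Finset.sum_sub_distrib, ← Finset.mul_sum, hqs.1.1.2, hp.1.2,
      div_eq_iff (G.prior_pos θ).ne']
    ring
  -- State `none` plays the Nash profile; state `some a` prescribes `a`, with the weights that make
  -- up the difference between `q` and `(1 - δ) p`.
  let ζ : Θ → stdSimplex ℝ (Option (∀ i, A i)) := fun θ =>
    ⟨fun z => z.elim (1 - δ) fun a => (q (a, θ) - (1 - δ) * p (a, θ)) / G.prior.1 θ, by
      rintro (_ | a)
      · exact sub_nonneg.2 hδ1.le
      · exact div_nonneg (sub_nonneg.2 (hqp' _)) (G.prior_pos θ).le, by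
      rw [Fintype.sum_option]
      change 1 - δ + ∑ a, (q (a, θ) - (1 - δ) * p (a, θ)) / G.prior.1 θ = 1
      rw [hsome]
      ring⟩
  let τ : ∀ j, Option (∀ i, A i) → Θ → stdSimplex ℝ (A j) := fun j z θ =>
    z.elim (α θ j) fun a => stdSimplex.vertex (a j)
  have hrep : ∀ a θ, q (a, θ) =
      ∑ z, (∏ j, (τ j z θ).1 (a j)) * ((ζ θ).1 z * G.prior.1 θ) := by
    intro a θ
    rw [Fintype.sum_option]
    change _ = (∏ j, (α θ j).1 (a j)) * ((1 - δ) * G.prior.1 θ) +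
      ∑ a', (∏ j, (stdSimplex.vertex (S := ℝ) (a' j)).1 (a j)) *
        ((q (a', θ) - (1 - δ) * p (a', θ)) / G.prior.1 θ * G.prior.1 θ)
    rw [Finset.sum_eq_single a]
    · have h1 : ∏ j, (stdSimplex.vertex (S := ℝ) (a j)).1 (a j) = 1 :=
        Finset.prod_eq_one fun j _ => by rw [vertex_apply, if_pos rfl]
      rw [h1, div_mul_cancel₀ _ (G.prior_pos θ).ne', hα' a θ]
      ring
    · intro a' _ hne
      obtain ⟨j, hj⟩ := Function.ne_iff.1 hne
      rw [Finset.prod_eq_zero (Finset.mem_univ j) (by rw [vertex_apply, if_neg hj]), zero_mul]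
    · simp
  -- In state `none` the redrawn law is `p` redrawn, up to the prior. Redrawing fixes `q`, which is
  -- within `δ * G.prior.1 θ` of `p`, so `p` moves by at most twice that.
  have hD : ∀ θ, ∑ a : (∀ j, A j), |∏ j, (redrawnLaw hq τ j none θ).1 (a j) -
      ∏ j, (α θ j).1 (a j)| ≤ 2 * δ := by
    intro θ
    have h1 := sum_abs_kernel_sub_le (F := fun a => q (a, θ))
      (k := fun j c => redraw hq j (condBelief q j c))
      (fun a j => sum_update_mul_redraw hq a j θ) fun a => p (a, θ)
    have h2 : ∀ a : ∀ j, A j, |∏ j, (redrawnLaw hq τ j none θ).1 (a j) -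
        ∏ j, (α θ j).1 (a j)| * G.prior.1 θ =
        |∑ a', p (a', θ) * ∏ j, (redraw hq j (condBelief q j (a' j))).1 (a j) - p (a, θ)| := by
      intro a
      rw [← abs_of_pos (G.prior_pos θ), ← abs_mul, sub_mul, ← hα']
      congr 2
      simp only [redrawnLaw, kernelComp_apply, Fintype.prod_sum, Finset.prod_mul_distrib,
        Finset.sum_mul]
      refine Finset.sum_congr rfl fun a' _ => ?_
      rw [hα']
      change _ * (∏ j, (α θ j).1 (a' j)) * _ = _
      ring
    simp only [← h2, ← Finset.sum_mul] at h1
    have h3 := hqd θ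
    refine le_of_mul_le_mul_right ?_ (G.prior_pos θ)
    linarith
  have hmix := mixture_redrawnLaw hq hrep
  suffices hsmall : ∀ i (r : Option (∀ i, A i) → Θ → A i), ∑ z, ∑ θ,
      G.statePayoff i (fun j z θ => (redrawnLaw hq τ j z θ).1) (r z θ) z θ *
        ((ζ θ).1 z * G.prior.1 θ) ≤ ∑ a, ∑ θ, G.u i a θ * q (a, θ) + ε / 2 by
    obtain ⟨T, hT, ξ, σ, heq, hcost, hout⟩ :=
      G.exists_technology_of_fintype hqs hq ζ τ hrep hε hsmall
    exact ⟨T, hT, ξ, σ, heq, hcost, fun a θ => by rw [hout]; exact hqε (a, θ)⟩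
  intro i r
  set K : ∀ j, Option (∀ i, A i) → Θ → stdSimplex ℝ (A j) := redrawnLaw hq τ with hK
  have hval : ∑ a, ∑ θ, G.u i a θ * q (a, θ) = ∑ z, ∑ θ,
      (∑ a, G.u i a θ * ∏ j, (K j z θ).1 (a j)) * ((ζ θ).1 z * G.prior.1 θ) := by
    simp only [← hmix, Finset.mul_sum, Finset.sum_mul]
    rw [Finset.sum_comm, Finset.sum_comm (s := (Finset.univ : Finset (Option (∀ i, A i))))]
    refine Finset.sum_congr rfl fun θ _ => ?_
    rw [Finset.sum_comm]
    exact Finset.sum_congr rfl fun z _ => Finset.sum_congr rfl fun a _ => by ring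
  have hw : ∀ z θ, 0 ≤ (ζ θ).1 z * G.prior.1 θ := fun z θ =>
    mul_nonneg ((ζ θ).2.1 z) (G.prior_pos θ).le
  have hgain : ∀ z θ, G.statePayoff i (fun j z θ => (K j z θ).1) (r z θ) z θ -
      ∑ a, G.u i a θ * ∏ j, (K j z θ).1 (a j) ≤ z.elim (4 * M * δ) fun _ => 2 * M := by
    -- In state `none` the near-Nash bound applies with distance `2 * δ`; elsewhere two payoffs
    -- bounded by `M` differ by at most `2 * M`.
    rintro (_ | a) θ
    · have h := G.statePayoff_le_of_near_nash K (fun j _ θ => α θ j) none θ (hM i)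
        (hnash θ i) (r none θ)
      have h' := mul_le_mul_of_nonneg_left (hD θ) (mul_nonneg zero_le_two hM0)
      change _ ≤ 4 * M * δ
      linarith
    · have h1 := le_of_abs_le (G.abs_statePayoff_le K (some a) θ (hM i) (r (some a) θ))
      have h2 := neg_le_of_abs_le (G.abs_sum_mul_prod_le K (some a) θ (hM i))
      change _ ≤ 2 * M
      linarith
  rw [hval, ← sub_le_iff_le_add', ← Finset.sum_sub_distrib]
  simp only [← Finset.sum_sub_distrib, ← sub_mul]
  calc _ ≤ ∑ z : Option (∀ i, A i), ∑ θ, (z.elim (4 * M * δ) fun _ => 2 * M) *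
        ((ζ θ).1 z * G.prior.1 θ) :=
        Finset.sum_le_sum fun z _ => Finset.sum_le_sum fun θ _ =>
          mul_le_mul_of_nonneg_right (hgain z θ) (hw z θ)
    _ = ∑ θ, (4 * M * δ * (1 - δ) + 2 * M * δ) * G.prior.1 θ := by
        rw [Finset.sum_comm]
        refine Finset.sum_congr rfl fun θ _ => ?_
        rw [Fintype.sum_option]
        change 4 * M * δ * ((1 - δ) * G.prior.1 θ) +
          ∑ a, 2 * M * ((q (a, θ) - (1 - δ) * p (a, θ)) / G.prior.1 θ * G.prior.1 θ) = _
        rw [← Finset.mul_sum, ← Finset.sum_mul, hsome]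
        ring
    _ = 4 * M * δ * (1 - δ) + 2 * M * δ := by
        rw [← Finset.mul_sum, G.prior.2.2, mul_one]
    _ ≤ ε / 2 := by nlinarith [mul_nonneg hM0 (sq_nonneg δ)]

end Sufficiency

end RationalInattention

theorem theorem5 {I Θ : Type*} {A : I → Type*} [Fintype I] [DecidableEq I] [Fintype Θ]
    [∀ i, Fintype (A i)] (G : RationalInattention.BaseGame I Θ A) (p : (∀ i, A i) × Θ → ℝ)
    (hp : G.IsCompleteInfoNash p) :
    G.IsVanishingCostEquilibrium p ↔ p ∈ closure G.sBCE :=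
  ⟨fun h => h.mem_closure_sBCE, fun h => hp.isVanishingCostEquilibrium h⟩
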